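/- Let $m$ be a natural number, let $(\Omega,\mathcal F,\mathbb P)$ be a probability space, and let $U,V:\Omega\to\mathbb R^m$ be random vectors such that $Y:=(U,V)$ has a non-degenerate centered Gaussian distribution on $\mathbb R^{2m}$. Let $\Sigma_{uu}=\mathbb E[UU^T]$, $\Sigma_{uv}=\mathbb E[UV^T]$, $\Sigma_{vu}=\mathbb E[VU^T]=\Sigma_{uv}^T$, $\Sigma_{vv}=\mathbb E[VV^T]$ be the blocks of its covariance matrix, and let $\nu$ be the law of $Y$. Notions. A possibly non-symmetric $m\times m$ matrix $A$ is positive-definite, $A>0$, if $\langle r,Ar\rangle>0$ for every $r\in\mathbb R^m\setminus\{0\}$; powers $C^\alpha$ of a symmetric $C>0$ are understood in the spectral sense. On $\mathbb R^{2m}$ let $S((r,s),(u,v))=\langle s,u\rangle+\langle r,v\rangle$. Relations between random variables hold almost surely, and $X$ is called $Y$-measurable if $X=g(Y)$ a.s. for a Borel function $g$. A $Y$-equilibrium is a pair $(R,f)$ of a square-integrable $Y$-measurable random vector $R$ in $\mathbb R^m$ and a Borel function $f:\mathbb R^m\to\mathbb R^m$ such that $f(R)=\mathbb E[V\mid R]$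 and, almost surely, $R-U$ maximizes $\langle q,V-f(q+U)\rangle$ over $q\in\mathbb R^m$. An optimal map maximizes $\frac12\mathbb E[S(X,Y)]$ over the square-integrable $Y$-measurable random vectors $X$ in $\mathbb R^{2m}$ with $\mathbb E[Y\mid X]=X$. An optimal plan maximizes $\frac12\int S(x,y)\,d\gamma$ over the Borel probability measures $\gamma(dx,dy)$ on $\mathbb R^{2m}\times\mathbb R^{2m}$ with finite second moments, with $y$-marginal $\nu$, and with $\gamma(y\mid x)=x$. A set $G\subset\mathbb R^{2m}$ is $S$-monotone if $S(x-y,x-y)\ge0$ for all $x,y\in G$, and maximal if it is not a strict subset of an $S$-monotone set. An optimal set minimizes $\int\psi_G\,d\nu$ over all maximal $S$-monotone sets $G$, where $\psi_G(y)=\sup_{x\in G}\bigl(S(x,y)-\frac12S(x,x)\bigr)$. Then: (a) The non-symmetric algebraic Riccati equation $$A\Sigma_{uu}A+(A\Sigma_{uv}-\Sigma_{vu}A)=\Sigma_{vv}$$ has a unique $m\times m$ matrix solution $A>0$. (b) Let $A>0$ be this solution. The $Y$-equilibrium $(R,f)$ is unique ($R$ almost surely, $f$ at every point) and has the form $$R=(A+A^T)^{-1}(A^TU+V),\qquad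 f(u)=Au,\quad u\in\mathbb R^m.$$ The random vector $X:=(R,f(R))$ is the (almost surely) unique optimal map, the law of $(X,Y)$ is the unique optimal plan, and the graph of $f$ is the unique optimal set. (c) The symmetric equation $\Lambda\Sigma_{uu}\Lambda=\Sigma_{vv}$ has the unique $m\times m$ positive-definite solution $$\Lambda=\Sigma_{uu}^{-1/2}\bigl(\Sigma_{uu}^{1/2}\Sigma_{vv}\Sigma_{uu}^{1/2}\bigr)^{1/2}\Sigma_{uu}^{-1/2}.$$ The matrix $A$ of (a) is symmetric if and only if $\Lambda\Sigma_{uv}=\Sigma_{vu}\Lambda$, that is, if and only if $\Lambda\Sigma_{uv}$ is symmetric. In this case $A=\Lambda$ and $R=\frac12(U+\Lambda^{-1}V)$. -/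

import Mathlib

open MeasureTheory ProbabilityTheory Filter Matrix

namespace BackwardTransport

/-- The Euclidean space `ℝ^m`. -/
abbrev Vec (m : ℕ) : Type := EuclideanSpace ℝ (Fin m)

/-- The phase space `ℝ^{2m} = ℝ^m × ℝ^m`. -/
abbrev Phase (m : ℕ) : Type := Vec m × Vec m

/-- The scalar product of the standard matrix `S = (0 I; I 0)`:
`S((r,s),(u,v)) = ⟨s,u⟩ + ⟨r,v⟩`. -/
noncomputable def stdS {m : ℕ} (x y : Phase m) : ℝ :=
  inner ℝ x.2 y.1 + inner ℝ x.1 y.2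

/-- `S`-monotone sets. -/
def IsSMonotone {m : ℕ} (G : Set (Phase m)) : Prop :=
  ∀ x ∈ G, ∀ y ∈ G, 0 ≤ stdS (x - y) (x - y)

/-- Maximal `S`-monotone sets: `S`-monotone sets that are not a strict subset of an
`S`-monotone set. -/
def IsMaximalSMonotone {m : ℕ} (G : Set (Phase m)) : Prop :=
  IsSMonotone G ∧ ∀ H : Set (Phase m), IsSMonotone H → G ⊆ H → G = H

/-- The Fitzpatrick function `ψ_G(y) = sup_{x ∈ G} (S(x,y) - S(x,x)/2)`, which may be `+∞`. -/
noncomputable def fitzpatrick {m : ℕ} (G : Set (Phase m)) (y : Phase m) : EReal :=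
  ⨆ x ∈ G, ((stdS x y - (1 / 2 : ℝ) * stdS x x : ℝ) : EReal)

/-- The expectation of an extended-real-valued function, as the integral of the positive part
minus the integral of the negative part. For the Fitzpatrick function of a nonempty set and a
law with finite second moment, the negative part has a finite integral. -/
noncomputable def extExpectation {α : Type*} [MeasurableSpace α] (ν : Measure α)
    (g : α → EReal) : EReal :=
  ((∫⁻ y, (g y).toENNReal ∂ν : ENNReal) : EReal) -
    ((∫⁻ y, (-g y).toENNReal ∂ν : ENNReal) : EReal)

/-- `G` minimizes `∫ ψ_G dν` over all maximal `S`-monotone sets (the dual problem). -/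
def IsOptimalSet {m : ℕ} (ν : Measure (Phase m)) (G : Set (Phase m)) : Prop :=
  IsMaximalSMonotone G ∧
    ∀ H : Set (Phase m), IsMaximalSMonotone H →
      extExpectation ν (fitzpatrick G) ≤ extExpectation ν (fitzpatrick H)

/-- `X` is `Y`-measurable: almost surely, `X` is a Borel function of `Y`. -/
def IsMeasurableWrt {Ω α β : Type*} [MeasurableSpace Ω] [MeasurableSpace α] [MeasurableSpace β]
    (P : Measure Ω) (X : Ω → β) (Y : Ω → α) : Prop :=
  ∃ g : α → β, Measurable g ∧ X =ᵐ[P] fun ω => g (Y ω)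

/-- Backward martingale maps: square-integrable `Y`-measurable random variables `X` such that
`E[Y | X] = X`. -/
structure IsBackwardMap {Ω : Type*} [MeasurableSpace Ω] {m : ℕ} (P : Measure Ω)
    (Y X : Ω → Phase m) : Prop where
  measurable : Measurable X
  memLp : MemLp X 2 P
  measurableWrt : IsMeasurableWrt P X Y
  condExp_eq : P[Y | MeasurableSpace.comap X inferInstance] =ᵐ[P] X

/-- `X` maximizes `E[S(X,Y)] / 2` over all backward martingale maps (the map problem). -/
def IsOptimalMap {Ω : Type*} [MeasurableSpace Ω] {m : ℕ} (P : Measure Ω)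
    (Y X : Ω → Phase m) : Prop :=
  IsBackwardMap P Y X ∧
    ∀ Z : Ω → Phase m, IsBackwardMap P Y Z →
      (1 / 2 : ℝ) * ∫ ω, stdS (Z ω) (Y ω) ∂P ≤ (1 / 2 : ℝ) * ∫ ω, stdS (X ω) (Y ω) ∂P

/-- Backward martingale plans: probability measures `γ(dx,dy)` with finite second moment, with
second marginal `ν`, and such that `γ(y | x) = x`. -/
structure IsBackwardPlan {m : ℕ} (ν : Measure (Phase m)) (γ : Measure (Phase m × Phase m)) :
    Prop where
  isProbabilityMeasure : IsProbabilityMeasure γ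
  memLp : MemLp id 2 γ
  map_snd : γ.map Prod.snd = ν
  condExp_eq : γ[(Prod.snd : Phase m × Phase m → Phase m) |
    MeasurableSpace.comap Prod.fst inferInstance] =ᵐ[γ] Prod.fst

/-- `γ` maximizes `∫ S(x,y) dγ / 2` over all backward martingale plans (the plan problem). -/
def IsOptimalPlan {m : ℕ} (ν : Measure (Phase m)) (γ : Measure (Phase m × Phase m)) : Prop :=
  IsBackwardPlan ν γ ∧
    ∀ γ' : Measure (Phase m × Phase m), IsBackwardPlan ν γ' →
      (1 / 2 : ℝ) * ∫ z, stdS z.1 z.2 ∂γ' ≤ (1 / 2 : ℝ) * ∫ z, stdS z.1 z.2 ∂γ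

/-- The pair `(R, f)` is a `Y`-equilibrium, `Y = (U, V)`: the total order `R` is `Y`-measurable,
the Borel pricing rule `f` is efficient, `f(R) = E[V | R]`, and almost surely the strategy
`Q = R - U` maximizes the insider profit `⟨q, V - f(q + U)⟩` over all `q ∈ ℝ^m`. -/
structure IsEquilibrium {Ω : Type*} [MeasurableSpace Ω] {m : ℕ} (P : Measure Ω)
    (U V R : Ω → Vec m) (f : Vec m → Vec m) : Prop where
  memLp_noise : MemLp U 2 P
  memLp_value : MemLp V 2 P
  measurable_order : Measurable R
  memLp_order : MemLp R 2 P
  measurable_price : Measurable f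
  measurableWrt : IsMeasurableWrt P R (fun ω => (U ω, V ω))
  efficient : (fun ω => f (R ω)) =ᵐ[P] P[V | MeasurableSpace.comap R inferInstance]
  profit_max : ∀ᵐ ω ∂P, ∀ q : Vec m,
    inner ℝ q (V ω - f (q + U ω)) ≤ inner ℝ (R ω - U ω) (V ω - f ((R ω - U ω) + U ω))

/-- Positive-definiteness of a possibly non-symmetric matrix: `⟨r, A r⟩ > 0` for all `r ≠ 0`. -/
def IsPositive {m : ℕ} (A : Matrix (Fin m) (Fin m) ℝ) : Prop :=
  ∀ r : Fin m → ℝ, r ≠ 0 → 0 < r ⬝ᵥ (A *ᵥ r)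

/-- The matrix `E[U Vᵀ]`. -/
noncomputable def crossMoment {Ω : Type*} [MeasurableSpace Ω] {m : ℕ} (P : Measure Ω)
    (U V : Ω → Vec m) : Matrix (Fin m) (Fin m) ℝ :=
  Matrix.of fun i j => ∫ ω, U ω i * V ω j ∂P

/-- The power `C^α` of a symmetric positive-definite matrix `C`, by functional calculus: `C^α`
has the eigenvectors of `C`, and its eigenvalues are raised to the power `α`. -/
noncomputable def matPow {m : ℕ} (C : Matrix (Fin m) (Fin m) ℝ) (α : ℝ) :
    Matrix (Fin m) (Fin m) ℝ :=
  cfc (fun t : ℝ => t ^ α) C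

/-- The action `u ↦ A u` of a matrix on `ℝ^m`. -/
noncomputable def act {m : ℕ} (A : Matrix (Fin m) (Fin m) ℝ) (u : Vec m) : Vec m :=
  WithLp.toLp 2 (A *ᵥ u.ofLp)

/-- The matrix `Λ = Σ_uu^{-1/2} (Σ_uu^{1/2} Σ_vv Σ_uu^{1/2})^{1/2} Σ_uu^{-1/2}`. -/
noncomputable def symLambda {m : ℕ} (Suu Svv : Matrix (Fin m) (Fin m) ℝ) :
    Matrix (Fin m) (Fin m) ℝ :=
  matPow Suu (-(1 / 2)) * matPow (matPow Suu (1 / 2) * Svv * matPow Suu (1 / 2)) (1 / 2) *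
    matPow Suu (-(1 / 2))

/-- The equation `A Σ_uu A + (A Σ_uv - Σ_vu A) = Σ_vv`. -/
def Riccati {m : ℕ} (Suu Suv Svu Svv A : Matrix (Fin m) (Fin m) ℝ) : Prop :=
  A * Suu * A + (A * Suv - Svu * A) = Svv

/-- The total order `R = (A + Aᵀ)⁻¹ (Aᵀ U + V)`. -/
noncomputable def linearOrder {Ω : Type*} {m : ℕ} (A : Matrix (Fin m) (Fin m) ℝ)
    (U V : Ω → Vec m) (ω : Ω) : Vec m :=
  act (A + Aᵀ)⁻¹ (act Aᵀ (U ω) + V ω)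

end BackwardTransport

open BackwardTransport

/-! Write `x_r = (r, A r)` for a positive matrix `A`. On the graph of `A` the form `S` is positive, and
`Π y = x_ρ`, `ρ = (A + Aᵀ)⁻¹ (Aᵀ u + v)`, is the `S`-orthogonal projection of `y = (u, v)` onto the
graph. Completing the square gives the Fitzpatrick function of the graph: it is the quadratic form
`ψ(y) = ⟨ρ, A ρ⟩ = S(Π y, Π y) / 2 = S(Π y, y) / 2`. It lies above `S(y, y) / 2`, with equality only
on the graph.

The Riccati equation says precisely that `A U - V` and `Aᵀ U + V` are uncorrelated. As `Y - Π Y` is a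
function of the first and `Π Y` of the second, the reflection `T = 2 Π - 1` preserves the covariance,
hence the Gaussian law `ν` (`IsPositive.measurePreserving_reflL`). All probabilistic facts are drawn
from this symmetry and from the full support of `ν`:

* `E[Y | Π Y]` is the average of `Y` and `T Y`, that is, `Π Y` (`condExp_ae_eq_of_reflL`).
* If `Z = E[Y | 𝓖]`, then `E S(Z, Y) / 2 = E S(Z, Z) / 2 ≤ E ψ(Z) ≤ E ψ(Y)`, with equality only for
  `Z = Π Y` (`IsPositive.half_integral_stdS_le`, `IsPositive.ae_eq_projL`). This settles maps and
  plans, a plan being treated as a map on the product space.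
* If the Fitzpatrick function of a set `G` lies above `S / 2` and below an integrable `φ`, then
  `ψ(y) = S(Π y, Π y) / 2 ≤ (φ(y) + φ(T y)) / 2`, hence `∫ ψ dν ≤ ∫ φ dν`; in the case of equality all
  points of `G` are in monotone relation with the graph of `A` (`integral_fitzForm_le`,
  `IsPositive.nonneg_of_integral_le_fitzForm`). The hypothesis on `G` holds for maximal monotone sets,
  which settles the set problem, and for the graph of any everywhere defined function.

For an equilibrium `(R, f)` profit maximization identifies the Fitzpatrick function of the graph of
`f` at `Y` with `S(X, Y) - S(X, X) / 2`, `X = (R, f(R))`, and by efficiency its expectation is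
`E S(Z, Z) / 2` for `Z = E[Y | R]`. The upper bound at `Z` and the lower bound at the graph of `f` are
thus both attained, whence `Z = Π Y` and `f(u) = A u` for every `u`, and then `R = ρ(Y)`
(`IsEquilibrium.unique`). No monotonicity or regularity of `f` is needed. Uniqueness of the solution
of the Riccati equation is a consequence.

For the existence let `Σ` be the covariance matrix of `Y` and let `Q` be the positive-definite
solution of the symmetric equation `Q Σ Q = S Σ S` in dimension `2 m`, which is explicit. By the
uniqueness of this solution `Q = S Q⁻¹ S`, so `S Q` is an involution, and it is the reflection `T` in
the sought graph (`exists_isPositiveForm_riccati`). The symmetric equation is uniquely solvable even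
among non-symmetric positive matrices by an argument with traces (`eq_of_mul_mul_self_eq`), which also
gives the symmetric case of the theorem. -/

namespace BackwardTransport

open scoped MatrixOrder

/-! ### Positive matrices, powers, and Riccati equations -/

section MatrixEquations

lemma _root_.Matrix.PosDef.isSymm {n : Type*} {A : Matrix n n ℝ} (hA : A.PosDef) : A.IsSymm := by
  have h := hA.1.eq
  rwa [Matrix.conjTranspose_eq_transpose_of_trivial] at h

variable {n : Type*} [Fintype n]

/-- Positivity of the quadratic form of a possibly non-symmetric matrix, for an arbitrary index
type; over `Fin m` this is `IsPositive`. -/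
def IsPositiveForm (A : Matrix n n ℝ) : Prop :=
  ∀ r : n → ℝ, r ≠ 0 → 0 < r ⬝ᵥ (A *ᵥ r)

lemma _root_.Matrix.PosDef.isPositiveForm {A : Matrix n n ℝ} (hA : A.PosDef) :
    IsPositiveForm A := fun r hr => by
  simpa using hA.dotProduct_mulVec_pos hr

lemma IsPositiveForm.posDef {A : Matrix n n ℝ} (hA : IsPositiveForm A) (hs : A.IsSymm) :
    A.PosDef :=
  Matrix.PosDef.of_dotProduct_mulVec_pos (by simpa [Matrix.IsHermitian] using hs.eq)
    fun r hr => by simpa using hA r hr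

lemma IsPositiveForm.add {A B : Matrix n n ℝ} (hA : IsPositiveForm A) (hB : IsPositiveForm B) :
    IsPositiveForm (A + B) := fun r hr => by
  rw [Matrix.add_mulVec, dotProduct_add]
  exact add_pos (hA r hr) (hB r hr)

lemma IsPositiveForm.transpose {A : Matrix n n ℝ} (hA : IsPositiveForm A) :
    IsPositiveForm Aᵀ := fun r hr => by
  rw [Matrix.mulVec_transpose, dotProduct_comm, ← Matrix.dotProduct_mulVec]
  exact hA r hr

lemma trace_transpose_mul_mul (P D : Matrix n n ℝ) :
    (Dᵀ * (P * D)).trace = ∑ i, D.col i ⬝ᵥ (P *ᵥ D.col i) :=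
  Finset.sum_congr rfl fun i _ => by
    simp [Matrix.mul_apply, dotProduct, Matrix.mulVec]

lemma IsPositiveForm.nonneg {P : Matrix n n ℝ} (hP : IsPositiveForm P) (r : n → ℝ) :
    0 ≤ r ⬝ᵥ (P *ᵥ r) := by
  rcases eq_or_ne r 0 with rfl | h0
  · simp
  · exact (hP _ h0).le

lemma trace_transpose_mul_mul_nonneg {P D : Matrix n n ℝ} (hP : IsPositiveForm P) :
    0 ≤ (Dᵀ * (P * D)).trace := by
  rw [trace_transpose_mul_mul]
  exact Finset.sum_nonneg fun i _ => hP.nonneg _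

lemma eq_zero_of_trace_transpose_mul_mul {P D : Matrix n n ℝ} (hP : IsPositiveForm P)
    (h : (Dᵀ * (P * D)).trace = 0) : D = 0 := by
  rw [trace_transpose_mul_mul, Finset.sum_eq_zero_iff_of_nonneg fun i _ => hP.nonneg _] at h
  ext i j
  have h0 : D.col j = 0 := by
    by_contra hne
    exact (hP _ hne).ne' (h j (Finset.mem_univ _))
  exact congrFun h0 i

variable [DecidableEq n]

lemma IsPositiveForm.isUnit_add_transpose {A : Matrix n n ℝ} (hA : IsPositiveForm A) :
    IsUnit (A + Aᵀ) :=
  ((hA.add hA.transpose).posDef (by simp [Matrix.IsSymm, add_comm])).isUnit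

/-- Congruence by an invertible symmetric matrix preserves positivity. -/
lemma IsPositiveForm.mul_mul {A h : Matrix n n ℝ} (hA : IsPositiveForm A) (hs : h.IsSymm)
    (hu : IsUnit h) : IsPositiveForm (h * A * h) := fun r hr => by
  have h1 : h *ᵥ r ≠ 0 := fun h0 =>
    hr (Matrix.mulVec_injective_of_isUnit hu (by simpa using h0))
  have h2 := hA _ h1
  rw [← Matrix.mulVec_mulVec, ← Matrix.mulVec_mulVec, Matrix.dotProduct_mulVec,
    ← Matrix.mulVec_transpose, hs.eq]
  exact h2

/-- The Sylvester equation `P D + D P = 0` with positive `P` has only the trivial solution: the traces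
of `Dᵀ P D` and of `D P Dᵀ` are nonnegative and add up to zero. -/
lemma eq_zero_of_mul_add_mul {P D : Matrix n n ℝ} (hP : IsPositiveForm P)
    (h : P * D + D * P = 0) : D = 0 := by
  refine eq_zero_of_trace_transpose_mul_mul hP (le_antisymm ?_ (trace_transpose_mul_mul_nonneg hP))
  have h1 : (Dᵀ * (P * D)).trace + (Dᵀ * (D * P)).trace = 0 := by
    rw [← Matrix.trace_add, ← mul_add, h]; simp
  have h2 : (Dᵀ * (D * P)).trace = (Dᵀᵀ * (P * Dᵀ)).trace := by
    rw [← mul_assoc, Matrix.mul_assoc, Matrix.trace_mul_comm, Matrix.transpose_transpose,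
      mul_assoc]
  have h3 := trace_transpose_mul_mul_nonneg (D := Dᵀ) hP
  linarith

end MatrixEquations

section Powers

variable {n : Type*} [Fintype n] [DecidableEq n]

lemma spectrum_pos_of_posDef {C : Matrix n n ℝ} (hC : C.PosDef) :
    ∀ t ∈ spectrum ℝ C, 0 < t := by
  rw [hC.1.spectrum_real_eq_range_eigenvalues]
  rintro _ ⟨i, rfl⟩
  exact hC.eigenvalues_pos i

lemma continuousOn_rpow_spectrum {C : Matrix n n ℝ} (hC : C.PosDef) (α : ℝ) :
    ContinuousOn (fun t : ℝ => t ^ α) (spectrum ℝ C) := fun t ht =>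
  (Real.continuousAt_rpow_const t α (Or.inl (spectrum_pos_of_posDef hC t ht).ne')).continuousWithinAt

lemma cfc_rpow_mul_cfc_rpow {C : Matrix n n ℝ} (hC : C.PosDef) (α β : ℝ) :
    cfc (fun t : ℝ => t ^ α) C * cfc (fun t : ℝ => t ^ β) C = cfc (fun t : ℝ => t ^ (α + β)) C := by
  rw [← cfc_mul _ _ C (continuousOn_rpow_spectrum hC α) (continuousOn_rpow_spectrum hC β)]
  exact cfc_congr fun t ht => (Real.rpow_add (spectrum_pos_of_posDef hC t ht) α β).symm

lemma cfc_rpow_zero {C : Matrix n n ℝ} (hC : C.PosDef) : cfc (fun t : ℝ => t ^ (0 : ℝ)) C = 1 := by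
  simpa using cfc_const_one ℝ C hC.1.isSelfAdjoint

lemma cfc_rpow_one {C : Matrix n n ℝ} (hC : C.PosDef) : cfc (fun t : ℝ => t ^ (1 : ℝ)) C = C := by
  simpa using cfc_id' ℝ C hC.1.isSelfAdjoint

lemma posDef_cfc_rpow {C : Matrix n n ℝ} (hC : C.PosDef) (α : ℝ) :
    (cfc (fun t : ℝ => t ^ α) C).PosDef := by
  have h0 : (cfc (fun t : ℝ => t ^ α) C).PosSemidef :=
    Matrix.nonneg_iff_posSemidef.1
      (cfc_nonneg fun t ht => Real.rpow_nonneg (spectrum_pos_of_posDef hC t ht).le α)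
  refine h0.posDef_iff_isUnit.2 (IsUnit.of_mul_eq_one (cfc (fun t : ℝ => t ^ (-α)) C) ?_)
  rw [cfc_rpow_mul_cfc_rpow hC, add_neg_cancel, cfc_rpow_zero hC]

/-- `K ↦ K C K` is injective on positive matrices, not only on symmetric ones: the difference of
two preimages solves a Sylvester equation after conjugation by `C^{1/2}`. -/
lemma eq_of_mul_mul_self_eq {C K L : Matrix n n ℝ} (hC : C.PosDef) (hK : IsPositiveForm K)
    (hL : IsPositiveForm L) (h : K * C * K = L * C * L) : K = L := by
  set r := cfc (fun t : ℝ => t ^ (1 / 2 : ℝ)) C with hr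
  have hrP : r.PosDef := posDef_cfc_rpow hC _
  have hrs : r.IsSymm := hrP.isSymm
  have hrr : r * r = C := by
    rw [hr, cfc_rpow_mul_cfc_rpow hC, add_halves, cfc_rpow_one hC]
  have h1 : (r * (K + L) * r) * (r * (K - L) * r) + (r * (K - L) * r) * (r * (K + L) * r) = 0 := by
    calc _ = r * ((K + L) * (r * r) * (K - L) + (K - L) * (r * r) * (K + L)) * r := by noncomm_ring
      _ = r * (2 • (K * C * K - L * C * L)) * r := by rw [hrr]; congr 2; noncomm_ring
      _ = 0 := by rw [h]; simp
  have h2 := eq_zero_of_mul_add_mul ((hK.add hL).mul_mul hrs hrP.isUnit) h1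
  have h3 : r * (K - L) = 0 := (hrP.isUnit.mul_left_eq_zero).1 h2
  exact sub_eq_zero.1 ((hrP.isUnit.mul_right_eq_zero).1 h3)

/-- The geometric-mean-type matrix `C^{-1/2} (C^{1/2} D C^{1/2})^{1/2} C^{-1/2}` is
positive-definite and solves `L C L = D`. -/
lemma posDef_and_mul_mul_self_eq {C D : Matrix n n ℝ} (hC : C.PosDef) (hD : D.PosDef) :
    let r := cfc (fun t : ℝ => t ^ (1 / 2 : ℝ)) C
    let s := cfc (fun t : ℝ => t ^ (-(1 / 2) : ℝ)) C
    let L := s * cfc (fun t : ℝ => t ^ (1 / 2 : ℝ)) (r * D * r) * s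
    L.PosDef ∧ L * C * L = D := by
  intro r s L
  have hrP : r.PosDef := posDef_cfc_rpow hC _
  have hsP : s.PosDef := posDef_cfc_rpow hC _
  have hrs : r.IsSymm := hrP.isSymm
  have hss : s.IsSymm := hsP.isSymm
  have hDs : D.IsSymm := hD.isSymm
  have hrr : r * r = C := by
    simp only [r]; rw [cfc_rpow_mul_cfc_rpow hC, add_halves, cfc_rpow_one hC]
  have hsr : s * r = 1 := by
    simp only [r, s]; rw [cfc_rpow_mul_cfc_rpow hC, neg_add_cancel, cfc_rpow_zero hC]
  have hrs1 : r * s = 1 := by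
    simp only [r, s]; rw [cfc_rpow_mul_cfc_rpow hC, add_neg_cancel, cfc_rpow_zero hC]
  have hE : (r * D * r).PosDef := (hD.isPositiveForm.mul_mul hrs hrP.isUnit).posDef (by
    simp [Matrix.IsSymm, Matrix.transpose_mul, hrs.eq, hDs.eq, mul_assoc])
  have hkP := posDef_cfc_rpow hE (1 / 2)
  have hks : (cfc (fun t : ℝ => t ^ (1 / 2 : ℝ)) (r * D * r)).IsSymm := hkP.isSymm
  refine ⟨(hkP.isPositiveForm.mul_mul hss hsP.isUnit).posDef (by
    rw [Matrix.IsSymm, Matrix.transpose_mul, Matrix.transpose_mul, hss.eq, hks.eq, ← mul_assoc]), ?_⟩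
  have hkk : cfc (fun t : ℝ => t ^ (1 / 2 : ℝ)) (r * D * r) *
      cfc (fun t : ℝ => t ^ (1 / 2 : ℝ)) (r * D * r) = r * D * r := by
    rw [cfc_rpow_mul_cfc_rpow hE, add_halves, cfc_rpow_one hE]
  simp only [L]
  generalize cfc (fun t : ℝ => t ^ (1 / 2 : ℝ)) (r * D * r) = k at hkk
  calc s * k * s * C * (s * k * s) = s * k * ((s * r) * (r * s)) * k * s := by
        rw [← hrr]; noncomm_ring
    _ = s * (k * k) * s := by rw [hsr, hrs1]; noncomm_ring
    _ = (s * r) * D * (r * s) := by rw [hkk]; noncomm_ring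
    _ = D := by rw [hsr, hrs1]; simp

/-- Existence of a positive solution of the non-symmetric Riccati equation. With `S` the block swap,
let `Q` be the positive-definite solution of `Q Σ Q = S Σ S`. Since `S Q⁻¹ S` is another one,
`Q S Q = S`, so that `T = S Q` is an involution with `T Σ = Σ Tᵀ`. The range of `(1 + T) / 2` is the
graph of the required matrix, which is read off from the blocks of `Q`. -/
lemma exists_isPositiveForm_riccati {Suu Suv Svu Svv : Matrix n n ℝ}
    (hM : (Matrix.fromBlocks Suu Suv Svu Svv).PosDef) :
    ∃ A : Matrix n n ℝ, IsPositiveForm A ∧ A * Suu * A + (A * Suv - Svu * A) = Svv := by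
  set M := Matrix.fromBlocks Suu Suv Svu Svv with hMd
  set S : Matrix (n ⊕ n) (n ⊕ n) ℝ := Matrix.fromBlocks 0 1 1 0 with hS
  have hSS : S * S = 1 := by simp [hS, Matrix.fromBlocks_multiply]
  have hSs : S.IsSymm := by simp [hS, Matrix.IsSymm, Matrix.fromBlocks_transpose]
  have hSu : IsUnit S := IsUnit.of_mul_eq_one _ hSS
  have hD : (S * M * S).PosDef := (hM.isPositiveForm.mul_mul hSs hSu).posDef (by
    rw [Matrix.IsSymm, Matrix.transpose_mul, Matrix.transpose_mul, hSs.eq, hM.isSymm.eq, mul_assoc])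
  obtain ⟨Q, hQ, hQM⟩ : ∃ Q : Matrix (n ⊕ n) (n ⊕ n) ℝ, Q.PosDef ∧ Q * M * Q = S * M * S :=
    ⟨_, posDef_and_mul_mul_self_eq hM hD⟩
  have hQi : Q⁻¹ * Q = 1 := Matrix.nonsing_inv_mul _ ((Matrix.isUnit_iff_isUnit_det _).1 hQ.isUnit)
  have hQi' : Q * Q⁻¹ = 1 := Matrix.mul_nonsing_inv _ ((Matrix.isUnit_iff_isUnit_det _).1 hQ.isUnit)
  have hQ' : Q = S * Q⁻¹ * S := by
    refine eq_of_mul_mul_self_eq hM hQ.isPositiveForm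
      (hQ.inv.isPositiveForm.mul_mul hSs hSu) ?_
    calc Q * M * Q = S * ((Q⁻¹ * Q) * M * (Q * Q⁻¹)) * S := by rw [hQi, hQi', hQM]; simp
      _ = S * Q⁻¹ * (Q * M * Q) * Q⁻¹ * S := by noncomm_ring
      _ = S * Q⁻¹ * S * M * (S * Q⁻¹ * S) := by rw [hQM]; noncomm_ring
  have hQSQ : Q * S * Q = S := by
    calc Q * S * Q = (S * Q⁻¹ * S) * S * Q := by rw [← hQ']
      _ = S * (Q⁻¹ * (S * S) * Q) := by noncomm_ring
      _ = S := by rw [hSS, mul_one, hQi, mul_one]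
  have hcomm : S * Q * M = M * Q * S := by
    calc S * Q * M = S * Q * M * ((Q * S * Q) * S) := by rw [hQSQ, hSS, mul_one]
      _ = S * (Q * M * Q) * S * Q * S := by noncomm_ring
      _ = (S * S) * M * (S * S) * Q * S := by rw [hQM]; noncomm_ring
      _ = M * Q * S := by rw [hSS]; simp
  have horth : (1 + S * Q) * M * (1 - Q * S) = 0 := by
    calc (1 + S * Q) * M * (1 - Q * S)
        = M + (S * Q * M - M * Q * S) - S * (Q * M * Q) * S := by noncomm_ring
      _ = M - (S * S) * M * (S * S) := by rw [hcomm, hQM]; noncomm_ring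
      _ = 0 := by rw [hSS]; simp
  set E := Q.toBlocks₁₁
  set F := Q.toBlocks₁₂
  set H := Q.toBlocks₂₂
  have hQb : Q = Matrix.fromBlocks E F Fᵀ H := by
    conv_lhs => rw [← Matrix.fromBlocks_toBlocks Q]
    congr 1
    ext i j
    exact congrFun (congrFun hQ.isSymm (Sum.inr i)) (Sum.inl j) ▸ rfl
  have hH : H.PosDef := hQ.submatrix Sum.inr_injective
  have hHi : H⁻¹ * H = 1 := Matrix.nonsing_inv_mul _ ((Matrix.isUnit_iff_isUnit_det _).1 hH.isUnit)
  have hHi' : H * H⁻¹ = 1 := Matrix.mul_nonsing_inv _ ((Matrix.isUnit_iff_isUnit_det _).1 hH.isUnit)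
  have hHis : (H⁻¹)ᵀ = H⁻¹ := hH.inv.isSymm
  have hFH : Fᵀ * H + H * F = 0 := by
    have h := congrArg Matrix.toBlocks₂₂ hQSQ
    rw [hQb] at h
    simpa [hS, Matrix.fromBlocks_multiply, add_comm] using h
  have hFH' : H⁻¹ * Fᵀ = - (F * H⁻¹) := by
    have h : H⁻¹ * (Fᵀ * H + H * F) * H⁻¹ = 0 := by rw [hFH]; simp
    have h' : H⁻¹ * (Fᵀ * H + H * F) * H⁻¹ = H⁻¹ * Fᵀ * (H * H⁻¹) + (H⁻¹ * H) * F * H⁻¹ := by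
      noncomm_ring
    rw [h', hHi, hHi'] at h
    simpa [eq_neg_iff_add_eq_zero] using h
  have hblock : ((1 + Fᵀ) * Suu + H * Svu) * (1 - F) - ((1 + Fᵀ) * Suv + H * Svv) * H = 0 := by
    have h : ((1 + S * Q) * M * (1 - Q * S)).toBlocks₁₁ = 0 := by rw [horth]; rfl
    rw [hQb, ← Matrix.fromBlocks_one] at h
    simpa [-Matrix.fromBlocks_one, hS, hMd, Matrix.fromBlocks_multiply, Matrix.fromBlocks_add,
      sub_eq_add_neg, Matrix.fromBlocks_neg] using h
  set B := H⁻¹ * (1 + Fᵀ) with hB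
  have hB1 : H * B = 1 + Fᵀ := by rw [hB, ← mul_assoc, hHi', one_mul]
  have hB2 : B * H = 1 - F := by
    rw [hB, mul_add, hFH', mul_one, add_mul, neg_mul, mul_assoc, hHi, mul_one, sub_eq_add_neg]
  have hric : B * Suu * B + Svu * B - B * Suv - Svv = 0 := by
    have h : H⁻¹ * (H * (B * Suu * B + Svu * B - B * Suv - Svv) * H) * H⁻¹ = 0 := by
      have : H * (B * Suu * B + Svu * B - B * Suv - Svv) * H =
          ((H * B) * Suu + H * Svu) * (B * H) - ((H * B) * Suv + H * Svv) * H := by noncomm_ring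
      rw [this, hB1, hB2, hblock]; simp
    have h' : H⁻¹ * (H * (B * Suu * B + Svu * B - B * Suv - Svv) * H) * H⁻¹ =
      (H⁻¹ * H) * (B * Suu * B + Svu * B - B * Suv - Svv) * (H * H⁻¹) := by noncomm_ring
    rwa [h', hHi, hHi', one_mul, mul_one] at h
  have hBB : B + Bᵀ = H⁻¹ + H⁻¹ := by
    rw [hB, Matrix.transpose_mul, hHis, mul_add, hFH']
    simp only [Matrix.transpose_add, Matrix.transpose_one, Matrix.transpose_transpose, add_mul,
      one_mul, mul_one]
    abel
  have hMt := hM.isSymm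
  rw [hMd, Matrix.IsSymm, Matrix.fromBlocks_transpose, Matrix.fromBlocks_inj] at hMt
  obtain ⟨huu, huv, hvu, hvv⟩ := hMt
  refine ⟨Bᵀ, fun r hr => ?_, ?_⟩
  · have h1 := (hH.inv.isPositiveForm.add hH.inv.isPositiveForm) r hr
    rw [← hBB, Matrix.add_mulVec, dotProduct_add] at h1
    have h2 : r ⬝ᵥ (B *ᵥ r) = r ⬝ᵥ (Bᵀ *ᵥ r) := by
      rw [Matrix.mulVec_transpose, dotProduct_comm r (r ᵥ* B), ← Matrix.dotProduct_mulVec]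
    linarith
  · have h := congrArg Matrix.transpose hric
    simp only [Matrix.transpose_sub, Matrix.transpose_add, Matrix.transpose_mul, huu, huv, hvu, hvv,
      Matrix.transpose_zero, ← mul_assoc] at h
    rw [← sub_eq_zero, ← h]
    noncomm_ring

end Powers

section SymmetricCase

variable {m : ℕ} {Suu Suv Svu Svv A : Matrix (Fin m) (Fin m) ℝ}

lemma posDef_symLambda (hu : Suu.PosDef) (hv : Svv.PosDef) : (symLambda Suu Svv).PosDef :=
  (posDef_and_mul_mul_self_eq hu hv).1

lemma symLambda_mul_mul (hu : Suu.PosDef) (hv : Svv.PosDef) :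
    symLambda Suu Svv * Suu * symLambda Suu Svv = Svv :=
  (posDef_and_mul_mul_self_eq hu hv).2

lemma eq_symLambda (hu : Suu.PosDef) (hv : Svv.PosDef) (hA : IsPositive A)
    (h : A * Suu * A = Svv) : A = symLambda Suu Svv :=
  eq_of_mul_mul_self_eq hu hA (posDef_symLambda hu hv).isPositiveForm
    (h.trans (symLambda_mul_mul hu hv).symm)

/-- For a symmetric solution the two sides of `A Σ_uu A - Σ_vv = Σ_vu A - A Σ_uv` are a symmetric
and an antisymmetric matrix, so both vanish. -/
lemma Riccati.of_isSymm (hu : Suu.PosDef) (hv : Svv.PosDef) (huv : Suvᵀ = Svu) (hA : A.IsSymm)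
    (h : Riccati Suu Suv Svu Svv A) : A * Suu * A = Svv ∧ A * Suv = Svu * A := by
  unfold Riccati at h
  have ht := congrArg Matrix.transpose h
  subst huv
  simp only [Matrix.transpose_add, Matrix.transpose_sub, Matrix.transpose_mul, hA.eq, hu.isSymm.eq,
    hv.isSymm.eq, Matrix.transpose_transpose, ← mul_assoc] at ht
  have h1 : A * Suv - Suvᵀ * A = 0 := by
    have h2 : (2 : ℝ) • (A * Suv - Suvᵀ * A) = 0 := by
      have h3 := sub_eq_zero.2 (h.trans ht.symm)
      rw [← h3, two_smul]; abel
    simpa using h2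
  refine ⟨by rw [h1, add_zero] at h; exact h, sub_eq_zero.1 h1⟩

lemma isSymm_mul_iff (hA : A.IsSymm) (huv : Suvᵀ = Svu) :
    (A * Suv).IsSymm ↔ A * Suv = Svu * A := by
  rw [Matrix.IsSymm, Matrix.transpose_mul, huv, hA.eq, eq_comm]

end SymmetricCase

end BackwardTransport

namespace BackwardTransport

/-! ### The projection onto the graph of a positive matrix and Fitzpatrick functions -/

variable {m : ℕ}

section LinearMaps

/-- The bilinear form `stdS` as a continuous bilinear map. -/
noncomputable def stdSL (m : ℕ) : Phase m →L[ℝ] Phase m →L[ℝ] ℝ :=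
  (innerSL ℝ).bilinearComp (ContinuousLinearMap.snd ℝ _ _) (ContinuousLinearMap.fst ℝ _ _) +
    (innerSL ℝ).bilinearComp (ContinuousLinearMap.fst ℝ _ _) (ContinuousLinearMap.snd ℝ _ _)

lemma stdSL_apply (x y : Phase m) : stdSL m x y = stdS x y := rfl

lemma stdS_comm (x y : Phase m) : stdS x y = stdS y x := by
  simp only [stdS]
  rw [real_inner_comm, real_inner_comm x.1 y.2, add_comm]

lemma stdS_add_right (x y z : Phase m) : stdS x (y + z) = stdS x y + stdS x z := by
  simp [← stdSL_apply]

lemma stdS_sub_sub (x y : Phase m) :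
    stdS (x - y) (x - y) = stdS x x - 2 * stdS x y + stdS y y := by
  have h : stdSL m y x = stdSL m x y := stdS_comm y x
  simp only [← stdSL_apply, map_sub, _root_.sub_apply, h]
  ring

lemma continuous_stdS {X : Type*} [TopologicalSpace X] {f g : X → Phase m} (hf : Continuous f)
    (hg : Continuous g) : Continuous fun x => stdS (f x) (g x) := by
  unfold stdS; fun_prop

/-- The continuous linear map `u ↦ A u`. -/
noncomputable def actL (A : Matrix (Fin m) (Fin m) ℝ) : Vec m →L[ℝ] Vec m :=
  Matrix.toEuclideanCLM (𝕜 := ℝ) A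

@[simp] lemma actL_apply (A : Matrix (Fin m) (Fin m) ℝ) (u : Vec m) : actL A u = act A u :=
  Matrix.toEuclideanCLM_toLp A u.ofLp

lemma act_act (A B : Matrix (Fin m) (Fin m) ℝ) (u : Vec m) : act A (act B u) = act (A * B) u := by
  simp [act, Matrix.mulVec_mulVec]

lemma act_one (u : Vec m) : act 1 u = u := by simp [act]

lemma act_add_left (A B : Matrix (Fin m) (Fin m) ℝ) (u : Vec m) :
    act (A + B) u = act A u + act B u := by
  simp [act, Matrix.add_mulVec]

lemma act_injective {A B : Matrix (Fin m) (Fin m) ℝ} (h : act A = act B) : A = B := by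
  refine Matrix.ext_of_mulVec_single fun i => ?_
  have := congrArg WithLp.ofLp (congrFun h (WithLp.toLp 2 (Pi.single i 1)))
  simpa [act] using this

lemma inner_act (A : Matrix (Fin m) (Fin m) ℝ) (x y : Vec m) :
    inner ℝ (act A x) y = inner ℝ x (act Aᵀ y) := by
  simp only [act, EuclideanSpace.inner_eq_star_dotProduct, star_trivial]
  rw [Matrix.mulVec_transpose, Matrix.dotProduct_mulVec]

lemma IsPositive.inner_act_pos {A : Matrix (Fin m) (Fin m) ℝ} (hA : IsPositive A) {x : Vec m}
    (hx : x ≠ 0) : 0 < inner ℝ x (act A x) := by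
  have h := hA x.ofLp (by simpa using hx)
  simpa [act, EuclideanSpace.inner_eq_star_dotProduct, dotProduct_comm] using h

lemma IsPositive.inner_act_nonneg {A : Matrix (Fin m) (Fin m) ℝ} (hA : IsPositive A) (x : Vec m) :
    0 ≤ inner ℝ x (act A x) := by
  rcases eq_or_ne x 0 with rfl | hx
  · simp
  · exact (hA.inner_act_pos hx).le

/-- The map `(u, v) ↦ (A + Aᵀ)⁻¹ (Aᵀ u + v)`, which expresses the order through the noise and the
value. -/
noncomputable def orderL (A : Matrix (Fin m) (Fin m) ℝ) : Phase m →L[ℝ] Vec m :=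
  (actL (A + Aᵀ)⁻¹).comp
    ((actL Aᵀ).comp (ContinuousLinearMap.fst ℝ _ _) + ContinuousLinearMap.snd ℝ _ _)

lemma orderL_apply (A : Matrix (Fin m) (Fin m) ℝ) (y : Phase m) :
    orderL A y = act (A + Aᵀ)⁻¹ (act Aᵀ y.1 + y.2) := by
  simp only [orderL, ContinuousLinearMap.comp_apply, _root_.add_apply, actL_apply,
    ContinuousLinearMap.coe_fst', ContinuousLinearMap.coe_snd']

/-- The `S`-orthogonal projection of the phase space onto the graph of `A`. -/
noncomputable def projL (A : Matrix (Fin m) (Fin m) ℝ) : Phase m →L[ℝ] Phase m :=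
  (orderL A).prod ((actL A).comp (orderL A))

lemma projL_apply (A : Matrix (Fin m) (Fin m) ℝ) (y : Phase m) :
    projL A y = (orderL A y, act A (orderL A y)) := by
  simp [projL]

/-- The graph of `u ↦ A u`. -/
def graphSet (A : Matrix (Fin m) (Fin m) ℝ) : Set (Phase m) :=
  Set.range fun u : Vec m => (u, act A u)

/-- The quadratic form `y ↦ ⟨ρ y, A ρ y⟩`, with `ρ = orderL A`. It is the Fitzpatrick function of
the graph of `A`. -/
noncomputable def fitzForm (A : Matrix (Fin m) (Fin m) ℝ) (y : Phase m) : ℝ :=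
  inner ℝ (orderL A y) (act A (orderL A y))

lemma continuous_act (A : Matrix (Fin m) (Fin m) ℝ) : Continuous (act A) := by
  have := (actL A).continuous
  simpa [funext (actL_apply A)] using this

lemma continuous_fitzForm (A : Matrix (Fin m) (Fin m) ℝ) : Continuous (fitzForm A) :=
  (orderL A).continuous.inner ((continuous_act A).comp (orderL A).continuous)

lemma half_stdS_projL (A : Matrix (Fin m) (Fin m) ℝ) (y : Phase m) :
    1 / 2 * stdS (projL A y) (projL A y) = fitzForm A y := by
  rw [projL_apply]
  simp only [stdS, fitzForm]
  rw [real_inner_comm (orderL A y)]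
  ring

variable {A : Matrix (Fin m) (Fin m) ℝ} (hA : IsPositive A)
include hA

lemma IsPositive.isUnit_add_transpose : IsUnit (A + Aᵀ) :=
  IsPositiveForm.isUnit_add_transpose hA

lemma IsPositive.act_orderL_add (y : Phase m) :
    act A (orderL A y) + act Aᵀ (orderL A y) = act Aᵀ y.1 + y.2 := by
  rw [← act_add_left, orderL_apply, act_act,
    Matrix.mul_nonsing_inv _ ((Matrix.isUnit_iff_isUnit_det _).1 hA.isUnit_add_transpose), act_one]

lemma IsPositive.orderL_eq {y : Phase m} {r : Vec m}
    (h : act A r + act Aᵀ r = act Aᵀ y.1 + y.2) : orderL A y = r := by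
  rw [orderL_apply, ← h, ← act_add_left, act_act,
    Matrix.nonsing_inv_mul _ ((Matrix.isUnit_iff_isUnit_det _).1 hA.isUnit_add_transpose), act_one]

lemma IsPositive.orderL_graph (u : Vec m) : orderL A (u, act A u) = u :=
  hA.orderL_eq (by simp [add_comm])

lemma IsPositive.orderL_projL (y : Phase m) : orderL A (projL A y) = orderL A y := by
  rw [projL_apply, hA.orderL_graph]

/-- Completing the square in `r ↦ S(x_r, y) - S(x_r, x_r) / 2`, where `x_r = (r, A r)`. -/
lemma IsPositive.stdS_graph_sub (r : Vec m) (y : Phase m) :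
    stdS (r, act A r) y - 1 / 2 * stdS (r, act A r) (r, act A r) =
      fitzForm A y - inner ℝ (r - orderL A y) (act A (r - orderL A y)) := by
  have h := congrArg (fun w : Vec m => inner ℝ r w) (hA.act_orderL_add y)
  simp only [inner_add_right] at h
  have e1 : inner ℝ r (act Aᵀ (orderL A y)) = inner ℝ (orderL A y) (act A r) := by
    rw [← inner_act, real_inner_comm]
  simp only [stdS, fitzForm, ← actL_apply, map_sub, inner_sub_left, inner_sub_right]
  simp only [actL_apply]
  rw [inner_act, real_inner_comm r (act A r)]
  linarith

lemma IsPositive.half_stdS_self (y : Phase m) :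
    1 / 2 * stdS y y = fitzForm A y - inner ℝ (y.1 - orderL A y) (act A (y.1 - orderL A y)) := by
  rw [← hA.stdS_graph_sub]
  simp only [stdS]
  rw [real_inner_comm y.2 y.1, real_inner_comm y.1 (act A y.1)]
  ring

lemma IsPositive.half_stdS_le_fitzForm (y : Phase m) : 1 / 2 * stdS y y ≤ fitzForm A y := by
  rw [hA.half_stdS_self y]
  linarith [hA.inner_act_nonneg (y.1 - orderL A y)]

lemma IsPositive.eq_projL_of_fitzForm_le {y : Phase m} (h : fitzForm A y ≤ 1 / 2 * stdS y y) :
    y = projL A y := by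
  have h1 : y.1 = orderL A y := by
    by_contra hne
    have := hA.inner_act_pos (sub_ne_zero.2 hne)
    linarith [hA.half_stdS_self y]
  have h2 := hA.act_orderL_add y
  rw [← h1, add_comm] at h2
  rw [projL_apply, ← h1, add_left_cancel h2]

lemma IsPositive.half_stdS_projL_left (y : Phase m) :
    1 / 2 * stdS (projL A y) y = fitzForm A y := by
  have h := hA.stdS_graph_sub (orderL A y) y
  rw [← projL_apply, half_stdS_projL, sub_self, inner_zero_left, sub_zero] at h
  linarith

end LinearMaps

section Fitzpatrick

lemma le_fitzpatrick {G : Set (Phase m)} {x : Phase m} (hx : x ∈ G) (y : Phase m) :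
    ((stdS x y - (1 / 2 : ℝ) * stdS x x : ℝ) : EReal) ≤ fitzpatrick G y :=
  le_iSup₂ (f := fun x (_ : x ∈ G) => ((stdS x y - (1 / 2 : ℝ) * stdS x x : ℝ) : EReal)) x hx

lemma fitzpatrick_le_coe_iff {G : Set (Phase m)} {y : Phase m} {c : ℝ} :
    fitzpatrick G y ≤ (c : EReal) ↔ ∀ x ∈ G, stdS x y - 1 / 2 * stdS x x ≤ c := by
  simp only [fitzpatrick, iSup₂_le_iff, EReal.coe_le_coe_iff]

lemma fitzpatrick_le_half_stdS_iff {G : Set (Phase m)} {y : Phase m} :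
    fitzpatrick G y ≤ ((1 / 2 * stdS y y : ℝ) : EReal) ↔ ∀ x ∈ G, 0 ≤ stdS (x - y) (x - y) := by
  rw [fitzpatrick_le_coe_iff]
  refine forall₂_congr fun x _ => ?_
  rw [stdS_sub_sub]
  constructor <;> intro h <;> linarith

lemma lowerSemicontinuous_fitzpatrick (G : Set (Phase m)) :
    LowerSemicontinuous (fitzpatrick G) := by
  refine lowerSemicontinuous_biSup fun x _ => Continuous.lowerSemicontinuous ?_
  exact continuous_coe_real_ereal.comp
    ((continuous_stdS continuous_const continuous_id).sub continuous_const)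

lemma IsMaximalSMonotone.mem {G : Set (Phase m)} (hG : IsMaximalSMonotone G) {y : Phase m}
    (h : ∀ x ∈ G, 0 ≤ stdS (x - y) (x - y)) : y ∈ G := by
  have h0 : ∀ z : Phase m, stdS (z - z) (z - z) = 0 := fun z => by simp [stdS]
  have h1 : IsSMonotone (insert y G) := by
    rintro a (rfl | ha) b (rfl | hb)
    · exact (h0 _).ge
    · have : stdS (a - b) (a - b) = stdS (b - a) (b - a) := by
        rw [stdS_sub_sub, stdS_sub_sub, stdS_comm a b]; ring
      rw [this]; exact h b hb
    · exact h a ha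
    · exact hG.1 a ha b hb
  rw [hG.2 _ h1 (Set.subset_insert y G)]
  exact Set.mem_insert y G

lemma IsMaximalSMonotone.half_stdS_le {G : Set (Phase m)} (hG : IsMaximalSMonotone G)
    (y : Phase m) : ((1 / 2 * stdS y y : ℝ) : EReal) ≤ fitzpatrick G y := by
  by_cases hy : y ∈ G
  · refine le_trans (le_of_eq ?_) (le_fitzpatrick hy y)
    congr 1; ring
  · by_contra hlt
    exact hy (hG.mem (fitzpatrick_le_half_stdS_iff.1 (not_le.1 hlt).le))

/-- The graph of an everywhere defined function dominates `S / 2`: to bound the Fitzpatrick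
function at `(u, v)` from below, use the point of the graph over `u`. -/
lemma half_stdS_le_fitzpatrick_range (f : Vec m → Vec m) (y : Phase m) :
    ((1 / 2 * stdS y y : ℝ) : EReal) ≤ fitzpatrick (Set.range fun r => (r, f r)) y := by
  refine le_trans (le_of_eq ?_) (le_fitzpatrick (Set.mem_range_self y.1) y)
  congr 1
  simp only [stdS]
  rw [real_inner_comm y.2 y.1, real_inner_comm y.1 (f y.1)]
  ring

variable {A : Matrix (Fin m) (Fin m) ℝ} (hA : IsPositive A)
include hA

lemma IsPositive.fitzpatrick_graphSet (y : Phase m) :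
    fitzpatrick (graphSet A) y = (fitzForm A y : EReal) := by
  refine le_antisymm (fitzpatrick_le_coe_iff.2 ?_) ?_
  · rintro _ ⟨r, rfl⟩
    rw [hA.stdS_graph_sub r y]
    linarith [hA.inner_act_nonneg (r - orderL A y)]
  · refine le_trans (le_of_eq ?_) (le_fitzpatrick (Set.mem_range_self (orderL A y)) y)
    rw [hA.stdS_graph_sub]
    simp

/-- Points in monotone relation with all of the graph of `A` belong to it. -/
lemma IsPositive.eq_projL_of_monotone {y : Phase m}
    (h : ∀ u : Vec m, 0 ≤ stdS ((u, act A u) - y) ((u, act A u) - y)) : y = projL A y := by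
  refine hA.eq_projL_of_fitzForm_le ?_
  have h1 := (fitzpatrick_le_half_stdS_iff (G := graphSet A) (y := y)).2
    (by rintro _ ⟨u, rfl⟩; exact h u)
  rw [hA.fitzpatrick_graphSet] at h1
  exact_mod_cast h1

lemma IsPositive.isMaximalSMonotone_graphSet : IsMaximalSMonotone (graphSet A) := by
  have hmono : IsSMonotone (graphSet A) := by
    rintro _ ⟨u, rfl⟩ _ ⟨v, rfl⟩
    have h := hA.inner_act_nonneg (u - v)
    have e : ((u, act A u) : Phase m) - (v, act A v) = (u - v, act A (u - v)) := by
      simp [← actL_apply]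
    rw [e]
    simp only [stdS]
    rw [real_inner_comm (u - v)]
    linarith
  refine ⟨hmono, fun H hH hsub => Set.Subset.antisymm hsub fun y hy => ?_⟩
  have h1 : y = projL A y := hA.eq_projL_of_monotone fun u => hH _ (hsub (Set.mem_range_self u)) _ hy
  exact ⟨orderL A y, by rw [h1, projL_apply, hA.orderL_graph]⟩

end Fitzpatrick

end BackwardTransport

namespace BackwardTransport

open scoped MatrixOrder

/-! ### Gaussian laws: full support and the reflection symmetry -/

section FullSupport

lemma isOpenPosMeasure_stdGaussian (ι : Type*) [Fintype ι] :
    (stdGaussian (EuclideanSpace ℝ ι)).IsOpenPosMeasure := by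
  have h : (gaussianReal 0 1).IsOpenPosMeasure :=
    (gaussianReal_absolutelyContinuous' 0 one_ne_zero).isOpenPosMeasure
  rw [stdGaussian_eq_map_pi_orthonormalBasis (EuclideanSpace.basisFun ι ℝ)]
  refine Continuous.isOpenPosMeasure_map (by fun_prop) fun x => ⟨fun i => x i, ?_⟩
  simpa using (EuclideanSpace.basisFun ι ℝ).sum_repr x

lemma isOpenPosMeasure_multivariateGaussian {ι : Type*} [Fintype ι] [DecidableEq ι]
    (μ : EuclideanSpace ℝ ι) {S : Matrix ι ι ℝ} (hS : S.PosDef) :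
    (multivariateGaussian μ S).IsOpenPosMeasure := by
  have h := isOpenPosMeasure_stdGaussian ι
  have hu : IsUnit (CFC.sqrt S) := by
    have h1 : CFC.sqrt S * CFC.sqrt S = S := CFC.sqrt_mul_sqrt_self S hS.posSemidef.nonneg
    have h2 := hS.isUnit
    rw [← h1] at h2
    exact isUnit_of_mul_isUnit_left h2
  rw [multivariateGaussian]
  refine Continuous.isOpenPosMeasure_map (by fun_prop) fun x => ?_
  refine ⟨Matrix.toEuclideanCLM (𝕜 := ℝ) (CFC.sqrt S)⁻¹ (x - μ), ?_⟩
  rw [← mul_apply_eq_comp, ← map_mul,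
    Matrix.mul_nonsing_inv _ ((Matrix.isUnit_iff_isUnit_det _).1 hu), map_one]
  simp

end FullSupport

variable {Ω : Type*} [MeasurableSpace Ω] {P : Measure Ω} {m : ℕ} {U V : Ω → Vec m}

section SecondMoments

lemma memLp_inner {X : Ω → Vec m} (hX : MemLp X 2 P) (a : Vec m) :
    MemLp (fun ω => inner ℝ a (X ω)) 2 P :=
  hX.continuousLinearMap_comp (innerSL ℝ a)

lemma integrable_inner_mul_inner {X Z : Ω → Vec m} (hX : MemLp X 2 P) (hZ : MemLp Z 2 P)
    (a b : Vec m) : Integrable (fun ω => inner ℝ a (X ω) * inner ℝ b (Z ω)) P :=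
  (memLp_inner hX a).integrable_mul (memLp_inner hZ b)

lemma integral_inner_mul_inner {X Z : Ω → Vec m} (hX : MemLp X 2 P) (hZ : MemLp Z 2 P)
    (a b : Vec m) : ∫ ω, inner ℝ a (X ω) * inner ℝ b (Z ω) ∂P =
      a.ofLp ⬝ᵥ (crossMoment P X Z *ᵥ b.ofLp) := by
  have hi : ∀ i j, Integrable (fun ω => X ω i * Z ω j) P := fun i j => by
    simpa [EuclideanSpace.inner_single_left] using integrable_inner_mul_inner hX hZ
      (EuclideanSpace.single i (1 : ℝ)) (EuclideanSpace.single j (1 : ℝ))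
  have h1 : ∀ ω, inner ℝ a (X ω) * inner ℝ b (Z ω) =
      ∑ i, ∑ j, (a i * b j) * (X ω i * Z ω j) := fun ω => by
    simp only [PiLp.inner_apply, RCLike.inner_apply, conj_trivial, Finset.sum_mul_sum]
    exact Finset.sum_congr rfl fun i _ => Finset.sum_congr rfl fun j _ => by ring
  simp only [h1]
  rw [integral_finsetSum _ fun i _ => integrable_finsetSum _ fun j _ => (hi i j).const_mul _]
  simp only [dotProduct, Matrix.mulVec, crossMoment, Matrix.of_apply, Finset.mul_sum]
  refine Finset.sum_congr rfl fun i _ => ?_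
  rw [integral_finsetSum _ fun j _ => (hi i j).const_mul _]
  refine Finset.sum_congr rfl fun j _ => ?_
  rw [integral_const_mul]
  ring

end SecondMoments

section Law

/-- The Euclidean space on `Fin m ⊕ Fin m` mapped onto the phase space. -/
noncomputable def sumToPhase (m : ℕ) : EuclideanSpace ℝ (Fin m ⊕ Fin m) →L[ℝ] Phase m :=
  LinearMap.toContinuousLinearMap
    { toFun := fun x => (WithLp.toLp 2 fun i => x (Sum.inl i), WithLp.toLp 2 fun i => x (Sum.inr i))
      map_add' := fun _ _ => rfl
      map_smul' := fun _ _ => rfl }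

/-- The phase space mapped onto the Euclidean space on `Fin m ⊕ Fin m`. -/
noncomputable def phaseToSum (m : ℕ) : Phase m →L[ℝ] EuclideanSpace ℝ (Fin m ⊕ Fin m) :=
  LinearMap.toContinuousLinearMap
    { toFun := fun y => WithLp.toLp 2 (Sum.elim y.1 y.2)
      map_add' := fun x y => by ext (i | i) <;> simp
      map_smul' := fun c y => by ext (i | i) <;> simp }

lemma inner_phaseToSum (t : EuclideanSpace ℝ (Fin m ⊕ Fin m)) (y : Phase m) :
    inner ℝ t (phaseToSum m y) =
      inner ℝ (sumToPhase m t).1 y.1 + inner ℝ (sumToPhase m t).2 y.2 := by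
  simp only [PiLp.inner_apply, Fintype.sum_sum_type]
  rfl

/-- A non-degenerate centered Gaussian law charges every nonempty open set. -/
lemma isOpenPosMeasure_map [IsProbabilityMeasure P]
    (hgauss : HasGaussianLaw (fun ω => (U ω, V ω)) P) (hcentered : ∫ ω, (U ω, V ω) ∂P = 0)
    (hnondeg : (Matrix.fromBlocks (crossMoment P U U) (crossMoment P U V) (crossMoment P V U)
      (crossMoment P V V)).PosDef) :
    (P.map fun ω => (U ω, V ω)).IsOpenPosMeasure := by
  set S := Matrix.fromBlocks (crossMoment P U U) (crossMoment P U V) (crossMoment P V U)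
      (crossMoment P V V) with hS
  have hU : MemLp U 2 P := hgauss.fst.memLp_two
  have hV : MemLp V 2 P := hgauss.snd.memLp_two
  have hW : HasGaussianLaw (fun ω => phaseToSum m (U ω, V ω)) P := hgauss.map_fun _
  have hYi : Integrable (fun ω => (U ω, V ω)) P := hgauss.integrable
  have hprob := Measure.isProbabilityMeasure_map (μ := P) hW.aemeasurable
  have hlaw : P.map (fun ω => phaseToSum m (U ω, V ω)) = multivariateGaussian 0 S := by
    refine Measure.ext_of_charFun (funext fun t => ?_)
    rw [hW.charFun_map_eq, charFun_multivariateGaussian hnondeg.posSemidef]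
    have h0 : ∫ ω, inner ℝ t (phaseToSum m (U ω, V ω)) ∂P = 0 := by
      have := ((innerSL ℝ t).comp (phaseToSum m)).integral_comp_comm hYi
      rw [hcentered, map_zero] at this
      exact this
    have hm : AEMeasurable (fun ω => inner ℝ t (phaseToSum m (U ω, V ω))) P :=
      (hW.map_fun (innerSL ℝ t)).aemeasurable
    rw [variance_of_integral_eq_zero hm h0, h0]
    have h1 : ∫ ω, inner ℝ t (phaseToSum m (U ω, V ω)) ^ 2 ∂P = t.ofLp ⬝ᵥ S *ᵥ t.ofLp := by
      simp only [inner_phaseToSum]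
      set a := (sumToPhase m t).1 with ha
      set b := (sumToPhase m t).2 with hb
      have e : ∀ ω, (inner ℝ a (U ω) + inner ℝ b (V ω)) ^ 2 =
          (inner ℝ a (U ω) * inner ℝ a (U ω) + inner ℝ a (U ω) * inner ℝ b (V ω)) +
          (inner ℝ b (V ω) * inner ℝ a (U ω) + inner ℝ b (V ω) * inner ℝ b (V ω)) := fun ω => by
        ring
      simp only [e]
      have hi1 := (integrable_inner_mul_inner hU hU a a).add (integrable_inner_mul_inner hU hV a b)
      have hi2 := (integrable_inner_mul_inner hV hU b a).add (integrable_inner_mul_inner hV hV b b)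
      rw [integral_add (by exact hi1) (by exact hi2),
        integral_add (integrable_inner_mul_inner hU hU a a)
          (integrable_inner_mul_inner hU hV a b),
        integral_add (integrable_inner_mul_inner hV hU b a)
          (integrable_inner_mul_inner hV hV b b),
        integral_inner_mul_inner hU hU, integral_inner_mul_inner hU hV,
        integral_inner_mul_inner hV hU, integral_inner_mul_inner hV hV]
      have ht : t.ofLp = Sum.elim a.ofLp b.ofLp := by
        funext i; rcases i with i | i <;> rfl
      rw [ht, hS, Matrix.fromBlocks_mulVec, sumElim_dotProduct_sumElim]
      simp [dotProduct_add]
    rw [h1]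
    simp
  have h2 := isOpenPosMeasure_multivariateGaussian 0 hnondeg
  rw [← hlaw] at h2
  have h3 := Continuous.isOpenPosMeasure_map
    (μ := P.map (fun ω => phaseToSum m (U ω, V ω))) (sumToPhase m).continuous
    fun y => ⟨phaseToSum m y, rfl⟩
  rwa [AEMeasurable.map_map_of_aemeasurable (sumToPhase m).continuous.aemeasurable
    hW.aemeasurable] at h3

/-- The reflection `2 Π - 1` through the graph of `A`. -/
noncomputable def reflL (A : Matrix (Fin m) (Fin m) ℝ) : Phase m →L[ℝ] Phase m :=
  (2 : ℝ) • projL A - ContinuousLinearMap.id ℝ _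

lemma reflL_apply (A : Matrix (Fin m) (Fin m) ℝ) (y : Phase m) :
    reflL A y = (2 : ℝ) • projL A y - y := by
  simp [reflL]

lemma add_reflL (A : Matrix (Fin m) (Fin m) ℝ) (y : Phase m) :
    y + reflL A y = (2 : ℝ) • projL A y := by
  rw [reflL_apply]; abel

lemma IsPositive.orderL_reflL {A : Matrix (Fin m) (Fin m) ℝ} (hA : IsPositive A) (y : Phase m) :
    orderL A (reflL A y) = orderL A y := by
  rw [reflL_apply, map_sub, map_smul, hA.orderL_projL, two_smul, add_sub_cancel_right]

/-- The residual `y - Π y` is a linear function of `A u - v`. -/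
lemma IsPositive.sub_projL {A : Matrix (Fin m) (Fin m) ℝ} (hA : IsPositive A) (y : Phase m) :
    y - projL A y = (act (A + Aᵀ)⁻¹ (act A y.1 - y.2),
      -act Aᵀ (act (A + Aᵀ)⁻¹ (act A y.1 - y.2))) := by
  have h := hA.act_orderL_add y
  have h1 : act (A + Aᵀ)⁻¹ (act A y.1 - y.2) = y.1 - orderL A y := by
    have e : act A y.1 - y.2 = act (A + Aᵀ) (y.1 - orderL A y) := by
      rw [← actL_apply (A + Aᵀ), map_sub, actL_apply, actL_apply, act_add_left, act_add_left, h]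
      abel
    rw [e, act_act, Matrix.nonsing_inv_mul _
      ((Matrix.isUnit_iff_isUnit_det _).1 hA.isUnit_add_transpose), act_one]
  rw [h1, projL_apply]
  refine Prod.ext rfl ?_
  rw [← actL_apply Aᵀ, map_sub, actL_apply, actL_apply]
  change y.2 - act A (orderL A y) = _
  rw [eq_sub_of_add_eq h]
  abel_nf

/-- The Riccati equation says that `A U - V` and `Aᵀ U + V` are uncorrelated. -/
lemma integral_inner_mul_inner_of_riccati {A : Matrix (Fin m) (Fin m) ℝ}
    (hU : MemLp U 2 P) (hV : MemLp V 2 P)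
    (hric : Riccati (crossMoment P U U) (crossMoment P U V) (crossMoment P V U)
      (crossMoment P V V) A) (a b : Vec m) :
    ∫ ω, inner ℝ a (act A (U ω) - V ω) * inner ℝ b (act Aᵀ (U ω) + V ω) ∂P = 0 := by
  have e : ∀ ω, inner ℝ a (act A (U ω) - V ω) * inner ℝ b (act Aᵀ (U ω) + V ω) =
      (inner ℝ (act Aᵀ a) (U ω) * inner ℝ (act A b) (U ω) +
        inner ℝ (act Aᵀ a) (U ω) * inner ℝ b (V ω)) -
      (inner ℝ a (V ω) * inner ℝ (act A b) (U ω) + inner ℝ a (V ω) * inner ℝ b (V ω)) := fun ω => by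
    simp only [inner_act, Matrix.transpose_transpose, inner_sub_right, inner_add_right]
    ring
  simp only [e]
  have hi1 := fun a b c d => (integrable_inner_mul_inner hU hU a b).add
    (integrable_inner_mul_inner hU hV c d)
  have hi2 := fun a b c d => (integrable_inner_mul_inner hV hU a b).add
    (integrable_inner_mul_inner hV hV c d)
  rw [integral_sub (by exact hi1 _ _ _ _) (by exact hi2 _ _ _ _),
    integral_add (integrable_inner_mul_inner hU hU _ _) (integrable_inner_mul_inner hU hV _ _),
    integral_add (integrable_inner_mul_inner hV hU _ _) (integrable_inner_mul_inner hV hV _ _),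
    integral_inner_mul_inner hU hU, integral_inner_mul_inner hU hV,
    integral_inner_mul_inner hV hU, integral_inner_mul_inner hV hV]
  unfold Riccati at hric
  rw [← hric]
  have h1 : ∀ w : Fin m → ℝ, (act Aᵀ a).ofLp ⬝ᵥ w = a.ofLp ⬝ᵥ (A *ᵥ w) := fun w => by
    simp only [act]
    rw [Matrix.mulVec_transpose, ← Matrix.dotProduct_mulVec]
  simp only [h1]
  simp only [act, Matrix.mulVec_mulVec, Matrix.add_mulVec, Matrix.sub_mulVec, dotProduct_add,
    dotProduct_sub, mul_assoc]
  ring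

/-- By the Riccati equation the reflection through the graph of
`A` preserves the covariance, hence the Gaussian law. -/
lemma IsPositive.measurePreserving_reflL [IsProbabilityMeasure P] {A : Matrix (Fin m) (Fin m) ℝ}
    (hA : IsPositive A) (hgauss : HasGaussianLaw (fun ω => (U ω, V ω)) P)
    (hcentered : ∫ ω, (U ω, V ω) ∂P = 0)
    (hric : Riccati (crossMoment P U U) (crossMoment P U V) (crossMoment P V U)
      (crossMoment P V V) A) :
    MeasurePreserving (reflL A) (P.map fun ω => (U ω, V ω)) (P.map fun ω => (U ω, V ω)) := by
  refine ⟨(reflL A).continuous.measurable, ?_⟩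
  have hU : MemLp U 2 P := hgauss.fst.memLp_two
  have hV : MemLp V 2 P := hgauss.snd.memLp_two
  have hYi : Integrable (fun ω => (U ω, V ω)) P := hgauss.integrable
  have hT : HasGaussianLaw (fun ω => reflL A (U ω, V ω)) P := hgauss.map_fun _
  rw [AEMeasurable.map_map_of_aemeasurable (reflL A).continuous.aemeasurable hgauss.aemeasurable]
  have hp1 := Measure.isProbabilityMeasure_map (μ := P) hT.aemeasurable
  have hp2 := Measure.isProbabilityMeasure_map (μ := P) hgauss.aemeasurable
  change P.map (fun ω => reflL A (U ω, V ω)) = _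
  refine Measure.ext_of_charFunDual (funext fun L => ?_)
  rw [hT.charFunDual_map_eq, hgauss.charFunDual_map_eq]
  have h0 : ∀ K : Phase m →L[ℝ] ℝ, ∫ ω, K (U ω, V ω) ∂P = 0 := fun K => by
    rw [K.integral_comp_comm hYi, hcentered, map_zero]
  have hL0 : ∫ ω, (L ∘ fun ω => (U ω, V ω)) ω ∂P = 0 := h0 L
  have hLT0 : ∫ ω, (L ∘ fun ω => reflL A (U ω, V ω)) ω ∂P = 0 := h0 (L.comp (reflL A))
  rw [variance_of_integral_eq_zero (hgauss.map L).aemeasurable hL0,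
    variance_of_integral_eq_zero (hT.map L).aemeasurable hLT0, hL0, hLT0]
  -- `L(T y)² - L(y)² = -4 L(y - Π y) L(Π y)`, a product of functionals of `A u - v`, `Aᵀ u + v`.
  let N : Vec m →L[ℝ] Phase m :=
    (actL (A + Aᵀ)⁻¹).prod (-(actL Aᵀ).comp (actL (A + Aᵀ)⁻¹))
  let G : Vec m →L[ℝ] Phase m :=
    (actL (A + Aᵀ)⁻¹).prod ((actL A).comp (actL (A + Aᵀ)⁻¹))
  let a := (InnerProductSpace.toDual ℝ (Vec m)).symm (L.comp N)
  let b := (InnerProductSpace.toDual ℝ (Vec m)).symm (L.comp G)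
  have ha : ∀ x, inner ℝ a x = L (N x) := fun x => by
    simp [a, InnerProductSpace.toDual_symm_apply]
  have hb : ∀ x, inner ℝ b x = L (G x) := fun x => by
    simp [b, InnerProductSpace.toDual_symm_apply]
  have hN : ∀ y : Phase m, N (act A y.1 - y.2) = y - projL A y := fun y => by
    rw [hA.sub_projL]; simp [N]
  have hG : ∀ y : Phase m, G (act Aᵀ y.1 + y.2) = projL A y := fun y => by
    rw [projL_apply, orderL_apply]
    simp [G, -map_add]
  have key : ∀ y : Phase m, L (reflL A y) ^ 2 =
      L y ^ 2 - 4 * (inner ℝ a (act A y.1 - y.2) * inner ℝ b (act Aᵀ y.1 + y.2)) := fun y => by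
    rw [ha, hb, hN, hG, reflL_apply]
    simp only [map_sub, map_smul, smul_eq_mul]
    ring
  have hi : Integrable (fun ω => inner ℝ a (act A (U ω) - V ω) *
      inner ℝ b (act Aᵀ (U ω) + V ω)) P := by
    refine integrable_inner_mul_inner ?_ ?_ a b
    · exact ((hU.continuousLinearMap_comp (actL A)).sub hV).ae_eq
        (Filter.Eventually.of_forall fun ω => by simp)
    · exact ((hU.continuousLinearMap_comp (actL Aᵀ)).add hV).ae_eq
        (Filter.Eventually.of_forall fun ω => by simp)
  have hi2 : Integrable (fun ω => L (U ω, V ω) ^ 2) P :=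
    (hgauss.memLp_two.continuousLinearMap_comp L).integrable_sq
  have hvar : ∫ ω, (L ∘ fun ω => reflL A (U ω, V ω)) ω ^ 2 ∂P =
      ∫ ω, (L ∘ fun ω => (U ω, V ω)) ω ^ 2 ∂P := by
    simp only [Function.comp_apply, key]
    rw [integral_sub hi2 (hi.const_mul 4), integral_const_mul,
      integral_inner_mul_inner_of_riccati hU hV hric, mul_zero, sub_zero]
  rw [hvar]

end Law

end BackwardTransport

namespace BackwardTransport

/-! ### Primal and dual bounds -/

section Orthogonality

variable {Ω : Type*} {mΩ : MeasurableSpace Ω} {P : Measure Ω} {E F : Type*}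
  [NormedAddCommGroup E] [NormedSpace ℝ E] [NormedAddCommGroup F] [NormedSpace ℝ F]

lemma integrable_bilin (B : F →L[ℝ] E →L[ℝ] ℝ) {X : Ω → F} {Y : Ω → E} (hX : MemLp X 2 P)
    (hY : MemLp Y 2 P) : Integrable (fun ω => B (X ω) (Y ω)) P :=
  memLp_one_iff_integrable.1 (ContinuousLinearMap.memLp_of_bilin 1 B hX hY)

/-- Orthogonality of `Y - E[Y | 𝓖]` and the `𝓖`-measurable square-integrable variables, with respect
to an arbitrary continuous bilinear form. -/
lemma integral_bilin_condExp [CompleteSpace E] [IsProbabilityMeasure P] (B : F →L[ℝ] E →L[ℝ] ℝ)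
    {𝓖 : MeasurableSpace Ω} (h𝓖 : 𝓖 ≤ mΩ) {X : Ω → F} {Y Z : Ω → E}
    (hX : MemLp X 2 P) (hXm : AEStronglyMeasurable[𝓖] X P) (hY : MemLp Y 2 P)
    (hZ : P[Y | 𝓖] =ᵐ[P] Z) :
    ∫ ω, B (X ω) (Y ω) ∂P = ∫ ω, B (X ω) (Z ω) ∂P := by
  rw [← integral_condExp h𝓖]
  refine integral_congr_ae ?_
  filter_upwards [condExp_bilin_of_aestronglyMeasurable_left B hXm (integrable_bilin B hX hY)
    (hY.integrable one_le_two), hZ] with ω h1 h2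
  rw [h1, h2]

end Orthogonality

variable {m : ℕ} {A : Matrix (Fin m) (Fin m) ℝ}

/-- The bilinear form whose restriction to the diagonal is `fitzForm A`. -/
noncomputable def fitzL (A : Matrix (Fin m) (Fin m) ℝ) : Phase m →L[ℝ] Phase m →L[ℝ] ℝ :=
  (innerSL ℝ).bilinearComp (orderL A) ((actL A).comp (orderL A))

lemma fitzL_self (A : Matrix (Fin m) (Fin m) ℝ) (y : Phase m) : fitzL A y y = fitzForm A y := by
  simp [fitzL, fitzForm]

lemma integrable_fitzForm {Ω : Type*} {mΩ : MeasurableSpace Ω} {P : Measure Ω}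
    (A : Matrix (Fin m) (Fin m) ℝ) {Y : Ω → Phase m} (hY : MemLp Y 2 P) :
    Integrable (fun ω => fitzForm A (Y ω)) P := by
  simpa only [fitzL_self] using integrable_bilin (fitzL A) hY hY

lemma integrable_stdS {Ω : Type*} {mΩ : MeasurableSpace Ω} {P : Measure Ω} {X Y : Ω → Phase m}
    (hX : MemLp X 2 P) (hY : MemLp Y 2 P) : Integrable (fun ω => stdS (X ω) (Y ω)) P := by
  simpa only [stdSL_apply] using integrable_bilin (stdSL m) hX hY

section WeakDuality

variable {Ω : Type*} {mΩ : MeasurableSpace Ω} {P : Measure Ω} [IsProbabilityMeasure P]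
  {𝓖 : MeasurableSpace Ω} {Y Z : Ω → Phase m}

lemma integral_stdS_condExp (h𝓖 : 𝓖 ≤ mΩ) (hY : MemLp Y 2 P) (hZ : P[Y | 𝓖] =ᵐ[P] Z) :
    ∫ ω, stdS (Z ω) (Y ω) ∂P = ∫ ω, stdS (Z ω) (Z ω) ∂P :=
  integral_bilin_condExp (stdSL m) h𝓖 ((hY.condExp one_le_two).ae_eq hZ)
    (stronglyMeasurable_condExp.aestronglyMeasurable.congr hZ) hY hZ

/-- The duality gap of a conditional expectation `Z` of `Y`: the integrand on the right-hand side is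
nonnegative and vanishes exactly when `Z` is the projection of `Y` onto the graph of `A`. -/
lemma integral_fitzForm_sub (A : Matrix (Fin m) (Fin m) ℝ) (h𝓖 : 𝓖 ≤ mΩ) (hY : MemLp Y 2 P)
    (hZ : P[Y | 𝓖] =ᵐ[P] Z) :
    ∫ ω, fitzForm A (Y ω) ∂P - 1 / 2 * ∫ ω, stdS (Z ω) (Y ω) ∂P =
      ∫ ω, (fitzForm A (Y ω - Z ω) + (fitzForm A (Z ω) - 1 / 2 * stdS (Z ω) (Z ω))) ∂P := by
  have hZ2 : MemLp Z 2 P := (hY.condExp one_le_two).ae_eq hZ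
  have hZm : AEStronglyMeasurable[𝓖] Z P :=
    stronglyMeasurable_condExp.aestronglyMeasurable.congr hZ
  have h1 : ∫ ω, fitzL A (Z ω) (Y ω) ∂P = ∫ ω, fitzForm A (Z ω) ∂P := by
    simpa only [fitzL_self] using integral_bilin_condExp (fitzL A) h𝓖 hZ2 hZm hY hZ
  have h2 : ∫ ω, fitzL A (Y ω) (Z ω) ∂P = ∫ ω, fitzForm A (Z ω) ∂P := by
    simpa only [ContinuousLinearMap.flip_apply, fitzL_self] using
      integral_bilin_condExp (fitzL A).flip h𝓖 hZ2 hZm hY hZ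
  have hYY := integrable_fitzForm A hY
  have hZZ := integrable_fitzForm A hZ2
  have hS := (integrable_stdS hZ2 hZ2).const_mul (1 / 2)
  have e : ∀ ω, fitzForm A (Y ω - Z ω) = (fitzForm A (Y ω) + fitzForm A (Z ω)) -
      (fitzL A (Z ω) (Y ω) + fitzL A (Y ω) (Z ω)) := fun ω => by
    simp only [← fitzL_self, map_sub, _root_.sub_apply]
    ring
  rw [integral_add (by exact integrable_fitzForm A (hY.sub hZ2)) (by exact hZZ.sub hS),
    integral_sub hZZ hS, integral_const_mul, integral_stdS_condExp h𝓖 hY hZ]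
  simp only [e]
  rw [integral_sub (by exact hYY.add hZZ)
      (by exact (integrable_bilin _ hZ2 hY).add (integrable_bilin _ hY hZ2)),
    integral_add hYY hZZ,
    integral_add (integrable_bilin _ hZ2 hY) (integrable_bilin _ hY hZ2), h1, h2]
  ring

lemma IsPositive.fitzForm_nonneg (hA : IsPositive A) (y : Phase m) : 0 ≤ fitzForm A y :=
  hA.inner_act_nonneg _

lemma IsPositive.gap_nonneg (hA : IsPositive A) (y z : Phase m) :
    0 ≤ fitzForm A (y - z) + (fitzForm A z - 1 / 2 * stdS z z) :=
  add_nonneg (hA.fitzForm_nonneg _) (sub_nonneg.2 (hA.half_stdS_le_fitzForm z))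

lemma IsPositive.half_integral_stdS_le (hA : IsPositive A) (h𝓖 : 𝓖 ≤ mΩ) (hY : MemLp Y 2 P)
    (hZ : P[Y | 𝓖] =ᵐ[P] Z) :
    1 / 2 * ∫ ω, stdS (Z ω) (Y ω) ∂P ≤ ∫ ω, fitzForm A (Y ω) ∂P := by
  have h : 0 ≤ ∫ ω, (fitzForm A (Y ω - Z ω) + (fitzForm A (Z ω) - 1 / 2 * stdS (Z ω) (Z ω))) ∂P :=
    integral_nonneg fun ω => hA.gap_nonneg (Y ω) (Z ω)
  rw [← integral_fitzForm_sub A h𝓖 hY hZ] at h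
  linarith

lemma IsPositive.ae_eq_projL (hA : IsPositive A) (h𝓖 : 𝓖 ≤ mΩ) (hY : MemLp Y 2 P)
    (hZ : P[Y | 𝓖] =ᵐ[P] Z)
    (hopt : ∫ ω, fitzForm A (Y ω) ∂P ≤ 1 / 2 * ∫ ω, stdS (Z ω) (Y ω) ∂P) :
    Z =ᵐ[P] fun ω => projL A (Y ω) := by
  have hZ2 : MemLp Z 2 P := (hY.condExp one_le_two).ae_eq hZ
  have h0 : ∫ ω, (fitzForm A (Y ω - Z ω) + (fitzForm A (Z ω) - 1 / 2 * stdS (Z ω) (Z ω))) ∂P = 0 :=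
    le_antisymm (by rw [← integral_fitzForm_sub A h𝓖 hY hZ]; linarith)
      (integral_nonneg fun ω => hA.gap_nonneg (Y ω) (Z ω))
  rw [integral_eq_zero_iff_of_nonneg (fun ω => hA.gap_nonneg (Y ω) (Z ω))
    ((integrable_fitzForm A (hY.sub hZ2)).add
      ((integrable_fitzForm A hZ2).sub ((integrable_stdS hZ2 hZ2).const_mul (1 / 2))))] at h0
  filter_upwards [h0] with ω hω
  have hω' : fitzForm A (Y ω - Z ω) + (fitzForm A (Z ω) - 1 / 2 * stdS (Z ω) (Z ω)) = 0 := hω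
  have h1 := hA.fitzForm_nonneg (Y ω - Z ω)
  have h2 := hA.half_stdS_le_fitzForm (Z ω)
  have h3 : Z ω = projL A (Z ω) := hA.eq_projL_of_fitzForm_le (by linarith)
  have h4 : orderL A (Y ω - Z ω) = 0 := by
    by_contra hne
    have : 0 < fitzForm A (Y ω - Z ω) := hA.inner_act_pos hne
    linarith
  rw [map_sub, sub_eq_zero] at h4
  rw [h3, projL_apply, projL_apply, h4]

end WeakDuality

section Reflection

variable {Ω : Type*} {mΩ : MeasurableSpace Ω} {P : Measure Ω} [IsProbabilityMeasure P]
  {Y : Ω → Phase m}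

/-- If the law of `Y` is invariant under the reflection `2 Π - 1` and `X` is a reflection invariant
function of `Y`, then the conditional expectation given `X` averages `Y` with its reflection, so
that it replaces `Y` by `Π Y`. -/
lemma condExp_ae_eq_of_reflL {E β : Type*} [NormedAddCommGroup E] [NormedSpace ℝ E]
    [CompleteSpace E] [MeasurableSpace β] (F : Phase m →L[ℝ] E)
    (hYm : Measurable Y) (hY : MemLp Y 2 P)
    (hT : MeasurePreserving (reflL A) (P.map Y) (P.map Y)) {X : Ω → β} (hX : Measurable X)
    {g : Phase m → β} (hg : Measurable g) (hgT : ∀ y, g (reflL A y) = g y)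
    (hXg : X =ᵐ[P] fun ω => g (Y ω))
    (hFm : AEStronglyMeasurable[MeasurableSpace.comap X inferInstance]
      (fun ω => F (projL A (Y ω))) P) :
    P[fun ω => F (Y ω) | MeasurableSpace.comap X inferInstance] =ᵐ[P]
      fun ω => F (projL A (Y ω)) := by
  have hFi : ∀ K : Phase m →L[ℝ] E, Integrable (fun ω => K (Y ω)) P := fun K =>
    (hY.continuousLinearMap_comp K).integrable one_le_two
  have hFm' : ∀ K : Phase m →L[ℝ] E, AEStronglyMeasurable K (P.map Y) := fun K => by
    exact K.continuous.aestronglyMeasurable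
  symm
  refine ae_eq_condExp_of_forall_setIntegral_eq hX.comap_le (hFi F) ?_ ?_ hFm
  · intro s _ _
    exact (hFi (F.comp (projL A))).integrableOn
  rintro s ⟨C, hC, rfl⟩ -
  have hgC : MeasurableSet (g ⁻¹' C) := hg hC
  have hset : X ⁻¹' C =ᵐ[P] Y ⁻¹' (g ⁻¹' C) := by
    filter_upwards [hXg] with ω hω
    change (X ω ∈ C) = (g (Y ω) ∈ C)
    rw [hω]
  have h1 : ∀ K : Phase m →L[ℝ] E, ∫ ω in Y ⁻¹' (g ⁻¹' C), K (Y ω) ∂P =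
      ∫ y in g ⁻¹' C, K y ∂(P.map Y) := fun K =>
    (setIntegral_map hgC (hFm' K) hYm.aemeasurable).symm
  have hinv : reflL A ⁻¹' (g ⁻¹' C) = g ⁻¹' C := by
    ext y; simp [hgT]
  have h2 : ∫ y in g ⁻¹' C, F y ∂(P.map Y) = ∫ y in g ⁻¹' C, F (reflL A y) ∂(P.map Y) := by
    conv_lhs => rw [← hT.map_eq]
    rw [setIntegral_map hgC (by rw [hT.map_eq]; exact hFm' F) hT.measurable.aemeasurable, hinv]
  have h4 := h1 (F.comp (projL A))
  simp only [ContinuousLinearMap.comp_apply] at h4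
  rw [setIntegral_congr_set hset, setIntegral_congr_set hset, h1 F, h4]
  have hFi' : ∀ K : Phase m →L[ℝ] E, Integrable K (P.map Y) := fun K =>
    (integrable_map_measure (hFm' K) hYm.aemeasurable).2 (hFi K)
  have h3 : (2 : ℝ) • ∫ y in g ⁻¹' C, (F.comp (projL A)) y ∂(P.map Y) =
      ∫ y in g ⁻¹' C, F y ∂(P.map Y) + ∫ y in g ⁻¹' C, F (reflL A y) ∂(P.map Y) := by
    rw [← integral_smul, ← integral_add (hFi' F).integrableOn
      (by exact (hFi' (F.comp (reflL A))).integrableOn)]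
    refine integral_congr_ae (Eventually.of_forall fun y => ?_)
    simp only [ContinuousLinearMap.comp_apply]
    rw [← map_add, add_reflL, map_smul]
  rw [← h2, ← two_smul ℝ] at h3
  exact smul_right_injective E (two_ne_zero (α := ℝ)) h3

end Reflection

section LowerBound

variable {ν : Measure (Phase m)} {G : Set (Phase m)} {φ : Phase m → ℝ}

/-- Midpoint convexity of the Fitzpatrick function, at `y` and its reflection. -/
lemma fitzpatrick_projL_le {y : Phase m} {c d : ℝ} (h1 : fitzpatrick G y ≤ c)
    (h2 : fitzpatrick G (reflL A y) ≤ d) :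
    fitzpatrick G (projL A y) ≤ (((c + d) / 2 : ℝ) : EReal) := by
  rw [fitzpatrick_le_coe_iff] at *
  intro x hx
  have h3 := congrArg (stdS x) (add_reflL A y)
  rw [stdS_add_right, two_smul, stdS_add_right] at h3
  linarith [h1 x hx, h2 x hx]

lemma ae_fitzForm_le (hT : MeasurePreserving (reflL A) ν ν)
    (hG : ∀ y, ((1 / 2 * stdS y y : ℝ) : EReal) ≤ fitzpatrick G y)
    (hle : ∀ᵐ y ∂ν, fitzpatrick G y ≤ φ y) :
    ∀ᵐ y ∂ν, fitzForm A y ≤ (φ y + φ (reflL A y)) / 2 ∧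
      fitzpatrick G (projL A y) ≤ (((φ y + φ (reflL A y)) / 2 : ℝ) : EReal) := by
  filter_upwards [hle, hT.quasiMeasurePreserving.ae hle] with y h1 h2
  have h3 := fitzpatrick_projL_le h1 h2
  refine ⟨?_, h3⟩
  have h4 := (hG (projL A y)).trans h3
  rw [half_stdS_projL] at h4
  exact_mod_cast h4

lemma integral_half_add_reflL (hT : MeasurePreserving (reflL A) ν ν) (hφ : Integrable φ ν) :
    ∫ y, (φ y + φ (reflL A y)) / 2 ∂ν = ∫ y, φ y ∂ν := by
  have h1 : ∫ y, φ (reflL A y) ∂ν = ∫ y, φ y ∂ν := by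
    conv_rhs => rw [← hT.map_eq]
    rw [integral_map hT.measurable.aemeasurable (by rw [hT.map_eq]; exact hφ.1)]
  have h2 : Integrable (fun y => φ (reflL A y)) ν := hT.integrable_comp_of_integrable hφ
  rw [integral_div, integral_add hφ h2, h1]
  ring

/-- Among the functions which dominate a Fitzpatrick function lying above `S / 2`, none has a
smaller integral than the Fitzpatrick function of the graph of `A`. -/
lemma integral_fitzForm_le (hT : MeasurePreserving (reflL A) ν ν) (hν : MemLp id 2 ν)
    (hG : ∀ y, ((1 / 2 * stdS y y : ℝ) : EReal) ≤ fitzpatrick G y) (hφ : Integrable φ ν)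
    (hle : ∀ᵐ y ∂ν, fitzpatrick G y ≤ φ y) :
    ∫ y, fitzForm A y ∂ν ≤ ∫ y, φ y ∂ν := by
  rw [← integral_half_add_reflL hT hφ]
  refine integral_mono_ae (integrable_fitzForm A hν)
    ((hφ.add (hT.integrable_comp_of_integrable hφ)).div_const 2) ?_
  filter_upwards [ae_fitzForm_le hT hG hle] with y hy using hy.1

/-- In the case of equality, all of `G` is in monotone relation with the graph of `A`. -/
lemma IsPositive.nonneg_of_integral_le_fitzForm (hA : IsPositive A) [ν.IsOpenPosMeasure]
    (hT : MeasurePreserving (reflL A) ν ν) (hν : MemLp id 2 ν)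
    (hG : ∀ y, ((1 / 2 * stdS y y : ℝ) : EReal) ≤ fitzpatrick G y) (hφ : Integrable φ ν)
    (hle : ∀ᵐ y ∂ν, fitzpatrick G y ≤ φ y) (hopt : ∫ y, φ y ∂ν ≤ ∫ y, fitzForm A y ∂ν)
    {x : Phase m} (hx : x ∈ G) (u : Vec m) :
    0 ≤ stdS (x - (u, act A u)) (x - (u, act A u)) := by
  have hi := (hφ.add (hT.integrable_comp_of_integrable hφ)).div_const 2
  have h1 := ae_fitzForm_le hT hG hle
  have h2 : (fitzForm A) =ᵐ[ν] fun y => (φ y + φ (reflL A y)) / 2 := by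
    refine (integral_eq_iff_of_ae_le (integrable_fitzForm A hν) hi (h1.mono fun y hy => hy.1)).1
      (le_antisymm (integral_mono_ae (integrable_fitzForm A hν) hi (h1.mono fun y hy => hy.1)) ?_)
    exact (integral_half_add_reflL hT hφ).trans_le hopt
  have h3 : ∀ᵐ y ∂ν, 0 ≤ stdS (x - projL A y) (x - projL A y) := by
    filter_upwards [h1, h2] with y hy1 hy2
    have h4 := hy1.2
    rw [← hy2, ← half_stdS_projL] at h4
    exact fitzpatrick_le_half_stdS_iff.1 h4 x hx
  have hcont : Continuous fun y => stdS (x - projL A y) (x - projL A y) :=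
    continuous_stdS (continuous_const.sub (projL A).continuous)
      (continuous_const.sub (projL A).continuous)
  -- `ν` charges every open set, so the almost sure inequality holds at every point.
  have h5 : (fun y => stdS (x - projL A y) (x - projL A y)) =
      fun y => max (stdS (x - projL A y) (x - projL A y)) 0 := by
    refine Measure.eq_of_ae_eq (μ := ν) ?_ hcont (hcont.max continuous_const)
    filter_upwards [h3] with y hy using (max_eq_left hy).symm
  have h6 := congrFun h5 (u, act A u)
  simp only [projL_apply, hA.orderL_graph] at h6
  rw [h6]
  exact le_max_right _ _

end LowerBound

section ExtendedExpectation

lemma extExpectation_congr {α : Type*} [MeasurableSpace α] {ν : Measure α} {f g : α → EReal}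
    (h : f =ᵐ[ν] g) : extExpectation ν f = extExpectation ν g := by
  unfold extExpectation
  rw [lintegral_congr_ae (h.mono fun y hy => congrArg EReal.toENNReal hy),
    lintegral_congr_ae (h.mono fun y hy => congrArg (fun t : EReal => (-t).toENNReal) hy)]

lemma extExpectation_coe {α : Type*} [MeasurableSpace α] {ν : Measure α} {φ : α → ℝ}
    (hφ : Integrable φ ν) : extExpectation ν (fun y => (φ y : EReal)) = ((∫ y, φ y ∂ν : ℝ) : EReal) := by
  have h1 : ∫⁻ y, ENNReal.ofReal (φ y) ∂ν ≠ ⊤ := hφ.lintegral_lt_top.ne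
  have h2 : ∫⁻ y, ENNReal.ofReal (-φ y) ∂ν ≠ ⊤ := hφ.neg.lintegral_lt_top.ne
  rw [integral_eq_lintegral_pos_part_sub_lintegral_neg_part hφ]
  unfold extExpectation
  simp only [← EReal.coe_neg, EReal.real_coe_toENNReal]
  rw [EReal.coe_sub, EReal.coe_ennreal_toReal h1, EReal.coe_ennreal_toReal h2]

/-- A Fitzpatrick function above `S / 2` has either infinite expectation or is almost everywhere
equal to an integrable function. -/
lemma extExpectation_fitzpatrick_cases {ν : Measure (Phase m)} (hν : MemLp id 2 ν)
    {G : Set (Phase m)} (hG : ∀ y, ((1 / 2 * stdS y y : ℝ) : EReal) ≤ fitzpatrick G y) :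
    extExpectation ν (fitzpatrick G) = ⊤ ∨ ∃ φ : Phase m → ℝ, Integrable φ ν ∧
      (∀ᵐ y ∂ν, fitzpatrick G y = φ y) ∧
      extExpectation ν (fitzpatrick G) = ((∫ y, φ y ∂ν : ℝ) : EReal) := by
  have hS : Integrable (fun y : Phase m => 1 / 2 * stdS y y) ν :=
    (integrable_stdS hν hν).const_mul _
  have hm : Measurable (fitzpatrick G) := (lowerSemicontinuous_fitzpatrick G).measurable
  by_cases htop : ∫⁻ y, (fitzpatrick G y).toENNReal ∂ν = ⊤
  · left
    have hneg : ∫⁻ y, (-fitzpatrick G y).toENNReal ∂ν ≠ ⊤ := by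
      refine ne_top_of_le_ne_top hS.neg.lintegral_lt_top.ne (lintegral_mono fun y => ?_)
      rw [← EReal.real_coe_toENNReal]
      exact EReal.toENNReal_le_toENNReal (by simpa using EReal.neg_le_neg_iff.2 (hG y))
    unfold extExpectation
    rw [htop, ← EReal.coe_ennreal_toReal hneg]
    exact EReal.top_sub_coe _
  · right
    have hfin : ∀ᵐ y ∂ν, fitzpatrick G y = ((fitzpatrick G y).toReal : EReal) := by
      filter_upwards [ae_lt_top hm.ereal_toENNReal htop] with y hy
      refine (EReal.coe_toReal (EReal.toENNReal_ne_top_iff.1 hy.ne) ?_).symm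
      exact ne_bot_of_le_ne_bot (EReal.coe_ne_bot _) (hG y)
    have hφ : Integrable (fun y => (fitzpatrick G y).toReal) ν := by
      refine Integrable.mono' ((integrable_toReal_of_lintegral_ne_top
        hm.ereal_toENNReal.aemeasurable htop).add hS.abs) hm.ereal_toReal.aestronglyMeasurable ?_
      filter_upwards [hfin] with y hy
      have h1 : (1 / 2 * stdS y y : ℝ) ≤ (fitzpatrick G y).toReal := by
        have := hG y
        rw [hy] at this
        exact_mod_cast this
      have h2 : (fitzpatrick G y).toENNReal.toReal = max (fitzpatrick G y).toReal 0 := by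
        conv_lhs => rw [hy, EReal.real_coe_toENNReal]
        exact ENNReal.toReal_ofReal'
      simp only [Pi.add_apply, h2, Real.norm_eq_abs]
      rcases le_total 0 (fitzpatrick G y).toReal with h3 | h3
      · rw [abs_of_nonneg h3, max_eq_left h3]
        linarith [abs_nonneg (1 / 2 * stdS y y)]
      · rw [abs_of_nonpos h3, max_eq_right h3]
        linarith [neg_abs_le (1 / 2 * stdS y y)]
    exact ⟨_, hφ, hfin, by rw [extExpectation_congr hfin, extExpectation_coe hφ]⟩

end ExtendedExpectation

end BackwardTransport

namespace BackwardTransport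

/-! ### Optimal maps, plans and sets, and equilibria -/

variable {m : ℕ} {A : Matrix (Fin m) (Fin m) ℝ}

section Maps

variable {Ω : Type*} [MeasurableSpace Ω] {P : Measure Ω} {Y : Ω → Phase m}

lemma IsPositive.projL_reflL (hA : IsPositive A) (y : Phase m) :
    projL A (reflL A y) = projL A y := by
  rw [projL_apply, hA.orderL_reflL, ← projL_apply]

lemma IsPositive.isBackwardMap_projL [IsProbabilityMeasure P] (hA : IsPositive A) (hYm : Measurable Y) (hY : MemLp Y 2 P)
    (hT : MeasurePreserving (reflL A) (P.map Y) (P.map Y)) :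
    IsBackwardMap P Y fun ω => projL A (Y ω) := by
  have hX : Measurable fun ω => projL A (Y ω) := (projL A).continuous.measurable.comp hYm
  refine ⟨hX, hY.continuousLinearMap_comp (projL A), ⟨projL A, (projL A).continuous.measurable,
    EventuallyEq.rfl⟩, ?_⟩
  exact condExp_ae_eq_of_reflL (ContinuousLinearMap.id ℝ _) hYm hY hT hX
    (projL A).continuous.measurable hA.projL_reflL EventuallyEq.rfl
    (comap_measurable _).stronglyMeasurable.aestronglyMeasurable

lemma IsPositive.half_integral_stdS_projL (hA : IsPositive A) :
    1 / 2 * ∫ ω, stdS (projL A (Y ω)) (Y ω) ∂P = ∫ ω, fitzForm A (Y ω) ∂P := by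
  rw [← integral_const_mul]
  exact integral_congr_ae (Eventually.of_forall fun ω => hA.half_stdS_projL_left (Y ω))

lemma IsPositive.isOptimalMap_projL [IsProbabilityMeasure P] (hA : IsPositive A) (hYm : Measurable Y) (hY : MemLp Y 2 P)
    (hT : MeasurePreserving (reflL A) (P.map Y) (P.map Y)) :
    IsOptimalMap P Y fun ω => projL A (Y ω) := by
  refine ⟨hA.isBackwardMap_projL hYm hY hT, fun Z hZ => ?_⟩
  rw [hA.half_integral_stdS_projL]
  exact hA.half_integral_stdS_le hZ.measurable.comap_le hY hZ.condExp_eq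

lemma IsPositive.ae_eq_projL_of_isOptimalMap [IsProbabilityMeasure P] (hA : IsPositive A) (hYm : Measurable Y)
    (hY : MemLp Y 2 P) (hT : MeasurePreserving (reflL A) (P.map Y) (P.map Y))
    {Z : Ω → Phase m} (hZ : IsOptimalMap P Y Z) : Z =ᵐ[P] fun ω => projL A (Y ω) := by
  refine hA.ae_eq_projL hZ.1.measurable.comap_le hY hZ.1.condExp_eq ?_
  rw [← hA.half_integral_stdS_projL]
  exact hZ.2 _ (hA.isBackwardMap_projL hYm hY hT)

end Maps

section Plans

variable {ν : Measure (Phase m)} {γ : Measure (Phase m × Phase m)}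

lemma IsBackwardPlan.memLp_snd (hγ : IsBackwardPlan ν γ) :
    MemLp (Prod.snd : Phase m × Phase m → Phase m) 2 γ :=
  hγ.memLp.snd

lemma IsBackwardPlan.integral_fitzForm_snd (hγ : IsBackwardPlan ν γ) :
    ∫ z, fitzForm A z.2 ∂γ = ∫ y, fitzForm A y ∂ν := by
  rw [← hγ.map_snd, integral_map measurable_snd.aemeasurable
    (continuous_fitzForm A).aestronglyMeasurable]

lemma IsPositive.half_integral_stdS_plan_le (hA : IsPositive A) (hγ : IsBackwardPlan ν γ) :
    1 / 2 * ∫ z, stdS z.1 z.2 ∂γ ≤ ∫ y, fitzForm A y ∂ν := by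
  have := hγ.isProbabilityMeasure
  rw [← hγ.integral_fitzForm_snd]
  exact hA.half_integral_stdS_le measurable_fst.comap_le hγ.memLp_snd hγ.condExp_eq

variable {Ω : Type*} [MeasurableSpace Ω] {P : Measure Ω} {Y : Ω → Phase m}

lemma measurable_projL_prodMk (hYm : Measurable Y) : Measurable fun ω => (projL A (Y ω), Y ω) :=
  ((projL A).continuous.measurable.comp hYm).prodMk hYm

lemma ae_map_fst_eq (hYm : Measurable Y) :
    (Prod.fst : Phase m × Phase m → Phase m) =ᵐ[P.map fun ω => (projL A (Y ω), Y ω)]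
      fun z => projL A z.2 := by
  have hset : MeasurableSet {z : Phase m × Phase m | z.1 = projL A z.2} :=
    measurableSet_eq_fun measurable_fst ((projL A).continuous.measurable.comp measurable_snd)
  rw [EventuallyEq, ae_map_iff (measurable_projL_prodMk hYm).aemeasurable hset]
  exact Eventually.of_forall fun ω => rfl

lemma map_snd_map (hYm : Measurable Y) :
    (P.map fun ω => (projL A (Y ω), Y ω)).map Prod.snd = P.map Y :=
  Measure.map_map measurable_snd (measurable_projL_prodMk hYm)

lemma IsPositive.isBackwardPlan_map [IsProbabilityMeasure P] (hA : IsPositive A) (hYm : Measurable Y) (hY : MemLp Y 2 P)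
    (hT : MeasurePreserving (reflL A) (P.map Y) (P.map Y)) :
    IsBackwardPlan (P.map Y) (P.map fun ω => (projL A (Y ω), Y ω)) := by
  have hm := measurable_projL_prodMk (A := A) hYm
  have hprob := Measure.isProbabilityMeasure_map (μ := P) hm.aemeasurable
  have hmem : MemLp id 2 (P.map fun ω => (projL A (Y ω), Y ω)) :=
    (memLp_map_measure_iff aestronglyMeasurable_id hm.aemeasurable).2
      (MemLp.of_fst_snd ⟨hY.continuousLinearMap_comp (projL A), hY⟩)
  refine ⟨hprob, hmem, map_snd_map hYm, ?_⟩
  have hfst := ae_map_fst_eq (P := P) (A := A) hYm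
  have hmeas : AEStronglyMeasurable[MeasurableSpace.comap Prod.fst inferInstance]
      (fun z : Phase m × Phase m => projL A z.2) (P.map fun ω => (projL A (Y ω), Y ω)) :=
    (comap_measurable _).stronglyMeasurable.aestronglyMeasurable.congr hfst
  refine (condExp_ae_eq_of_reflL (ContinuousLinearMap.id ℝ _) measurable_snd hmem.snd ?_
    measurable_fst (projL A).continuous.measurable hA.projL_reflL hfst hmeas).trans hfst.symm
  rwa [map_snd_map hYm]

lemma IsPositive.half_integral_stdS_map (hA : IsPositive A) (hYm : Measurable Y) :
    1 / 2 * ∫ z, stdS z.1 z.2 ∂(P.map fun ω => (projL A (Y ω), Y ω)) =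
      ∫ y, fitzForm A y ∂(P.map Y) := by
  rw [integral_map (measurable_projL_prodMk hYm).aemeasurable
      (continuous_stdS continuous_fst continuous_snd).aestronglyMeasurable,
    integral_map hYm.aemeasurable (continuous_fitzForm A).aestronglyMeasurable]
  exact hA.half_integral_stdS_projL

lemma IsPositive.isOptimalPlan_map [IsProbabilityMeasure P] (hA : IsPositive A) (hYm : Measurable Y) (hY : MemLp Y 2 P)
    (hT : MeasurePreserving (reflL A) (P.map Y) (P.map Y)) :
    IsOptimalPlan (P.map Y) (P.map fun ω => (projL A (Y ω), Y ω)) := by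
  refine ⟨hA.isBackwardPlan_map hYm hY hT, fun γ' hγ' => ?_⟩
  rw [hA.half_integral_stdS_map hYm]
  exact hA.half_integral_stdS_plan_le hγ'

lemma IsPositive.eq_map_of_isOptimalPlan [IsProbabilityMeasure P] (hA : IsPositive A) (hYm : Measurable Y)
    (hY : MemLp Y 2 P) (hT : MeasurePreserving (reflL A) (P.map Y) (P.map Y))
    (hγ : IsOptimalPlan (P.map Y) γ) : γ = P.map fun ω => (projL A (Y ω), Y ω) := by
  have := hγ.1.isProbabilityMeasure
  have hfst : (Prod.fst : Phase m × Phase m → Phase m) =ᵐ[γ] fun z => projL A z.2 := by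
    refine hA.ae_eq_projL measurable_fst.comap_le hγ.1.memLp_snd hγ.1.condExp_eq ?_
    rw [hγ.1.integral_fitzForm_snd, ← hA.half_integral_stdS_map hYm]
    exact hγ.2 _ (hA.isBackwardPlan_map hYm hY hT)
  have hm : Measurable fun y : Phase m => (projL A y, y) :=
    (projL A).continuous.measurable.prodMk measurable_id
  calc γ = γ.map id := Measure.map_id.symm
    _ = γ.map fun z => (projL A z.2, z.2) :=
      Measure.map_congr (hfst.mono fun z hz => Prod.ext hz rfl)
    _ = (γ.map Prod.snd).map fun y => (projL A y, y) := (Measure.map_map hm measurable_snd).symm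
    _ = (P.map Y).map fun y => (projL A y, y) := by rw [hγ.1.map_snd]
    _ = P.map fun ω => (projL A (Y ω), Y ω) := Measure.map_map hm hYm

end Plans

section Sets

variable {ν : Measure (Phase m)}

lemma stdS_sub_comm (x y : Phase m) : stdS (x - y) (x - y) = stdS (y - x) (y - x) := by
  rw [stdS_sub_sub, stdS_sub_sub, stdS_comm x y]; ring

lemma IsPositive.extExpectation_graphSet (hA : IsPositive A) (hν : MemLp id 2 ν) :
    extExpectation ν (fitzpatrick (graphSet A)) = ((∫ y, fitzForm A y ∂ν : ℝ) : EReal) := by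
  rw [funext hA.fitzpatrick_graphSet, extExpectation_coe (by exact integrable_fitzForm A hν)]

lemma IsPositive.isOptimalSet_graphSet (hA : IsPositive A) (hν : MemLp id 2 ν)
    (hT : MeasurePreserving (reflL A) ν ν) : IsOptimalSet ν (graphSet A) := by
  refine ⟨hA.isMaximalSMonotone_graphSet, fun H hH => ?_⟩
  rcases extExpectation_fitzpatrick_cases hν hH.half_stdS_le with h | ⟨φ, hφ, hle, h⟩
  · rw [h]; exact le_top
  · rw [h, hA.extExpectation_graphSet hν, EReal.coe_le_coe_iff]
    exact integral_fitzForm_le hT hν hH.half_stdS_le hφ (hle.mono fun y hy => hy.le)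

lemma IsPositive.eq_graphSet_of_isOptimalSet (hA : IsPositive A) [ν.IsOpenPosMeasure]
    (hν : MemLp id 2 ν) (hT : MeasurePreserving (reflL A) ν ν) {G : Set (Phase m)}
    (hG : IsOptimalSet ν G) : G = graphSet A := by
  have hopt := hG.2 _ hA.isMaximalSMonotone_graphSet
  rw [hA.extExpectation_graphSet hν] at hopt
  rcases extExpectation_fitzpatrick_cases hν hG.1.half_stdS_le with h | ⟨φ, hφ, hle, h⟩
  · rw [h] at hopt
    exact absurd (top_le_iff.1 hopt) (EReal.coe_ne_top _)
  · rw [h, EReal.coe_le_coe_iff] at hopt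
    refine (hA.isMaximalSMonotone_graphSet.2 G hG.1.1 ?_).symm
    rintro _ ⟨u, rfl⟩
    exact hG.1.mem fun x hx => hA.nonneg_of_integral_le_fitzForm hT hν hG.1.half_stdS_le hφ
      (hle.mono fun y hy => hy.le) hopt hx u

end Sets

section Equilibrium

variable {Ω : Type*} [MeasurableSpace Ω] {P : Measure Ω} {U V R : Ω → Vec m}
  {f : Vec m → Vec m}

/-- Up to a term independent of the order `r`, the profit `⟨r - u, v - f(r)⟩` is the function
maximized in the definition of the Fitzpatrick function of the graph of `f`. -/
lemma inner_sub_sub_eq (r s u v : Vec m) :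
    inner ℝ (r - u) (v - s) =
      stdS (r, s) (u, v) - 1 / 2 * stdS (r, s) (r, s) - inner ℝ u v := by
  simp only [stdS, inner_sub_left, inner_sub_right]
  rw [real_inner_comm s r, real_inner_comm s u]
  ring

lemma IsPositive.isEquilibrium [IsProbabilityMeasure P] (hA : IsPositive A) (hU : Measurable U) (hV : Measurable V)
    (hY : MemLp (fun ω => (U ω, V ω)) 2 P)
    (hT : MeasurePreserving (reflL A) (P.map fun ω => (U ω, V ω)) (P.map fun ω => (U ω, V ω))) :
    IsEquilibrium P U V (fun ω => orderL A (U ω, V ω)) (act A) := by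
  have hYm : Measurable fun ω => (U ω, V ω) := hU.prodMk hV
  have hRm : Measurable fun ω => orderL A (U ω, V ω) :=
    (orderL A).continuous.measurable.comp hYm
  refine ⟨hY.fst, hY.snd, hRm, hY.continuousLinearMap_comp (orderL A),
    (continuous_act A).measurable, ⟨orderL A, (orderL A).continuous.measurable, EventuallyEq.rfl⟩,
    ?_, ?_⟩
  · have hmeas : AEStronglyMeasurable[MeasurableSpace.comap (fun ω => orderL A (U ω, V ω))
        inferInstance] (fun ω => act A (orderL A (U ω, V ω))) P :=
      ((continuous_act A).measurable.comp
        (comap_measurable _)).stronglyMeasurable.aestronglyMeasurable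
    have h := condExp_ae_eq_of_reflL (ContinuousLinearMap.snd ℝ (Vec m) (Vec m)) hYm hY hT hRm
      (orderL A).continuous.measurable hA.orderL_reflL EventuallyEq.rfl
      (by simpa [projL_apply] using hmeas)
    simpa [projL_apply] using h.symm
  · refine Eventually.of_forall fun ω q => ?_
    have h1 := inner_sub_sub_eq (q + U ω) (act A (q + U ω)) (U ω) (V ω)
    have h2 := inner_sub_sub_eq (orderL A (U ω, V ω)) (act A (orderL A (U ω, V ω))) (U ω) (V ω)
    rw [hA.stdS_graph_sub] at h1 h2
    rw [add_sub_cancel_right] at h1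
    rw [sub_add_cancel, h1, h2]
    have := hA.inner_act_nonneg (q + U ω - orderL A (U ω, V ω))
    simp only [sub_self, inner_zero_left]
    linarith

/-- Profit maximization: the Fitzpatrick function of the graph of the pricing rule is attained, at
`Y`, in the point `(R, f(R))`. -/
lemma IsEquilibrium.ae_fitzpatrick_le (h : IsEquilibrium P U V R f) :
    ∀ᵐ ω ∂P, fitzpatrick (Set.range fun r => (r, f r)) (U ω, V ω) ≤
      ((stdS (R ω, f (R ω)) (U ω, V ω) -
        1 / 2 * stdS (R ω, f (R ω)) (R ω, f (R ω)) : ℝ) : EReal) := by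
  filter_upwards [h.profit_max] with ω hω
  rw [fitzpatrick_le_coe_iff]
  rintro _ ⟨r, rfl⟩
  have h1 := hω (r - U ω)
  rw [sub_add_cancel, sub_add_cancel, inner_sub_sub_eq, inner_sub_sub_eq] at h1
  linarith

lemma IsEquilibrium.memLp_point [IsProbabilityMeasure P] (h : IsEquilibrium P U V R f) :
    MemLp (fun ω => (R ω, f (R ω))) 2 P :=
  MemLp.of_fst_snd
    ⟨h.memLp_order, (h.memLp_value.condExp one_le_two).ae_eq h.efficient.symm⟩

/-- The expectation of `S(X, Y) - S(X, X) / 2`, `X = (R, f(R))`, is the value at the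
conditional expectation `Z` of `Y` given `R`. The market efficiency gives `Z` and `X` the same
second component, which is all that is needed. -/
lemma IsEquilibrium.integral_eq [IsProbabilityMeasure P] (h : IsEquilibrium P U V R f) {Z : Ω → Phase m}
    (hZ : P[fun ω => (U ω, V ω) | MeasurableSpace.comap R inferInstance] =ᵐ[P] Z)
    (hZ2 : ∀ᵐ ω ∂P, (Z ω).2 = f (R ω)) :
    ∫ ω, (stdS (R ω, f (R ω)) (U ω, V ω) - 1 / 2 * stdS (R ω, f (R ω)) (R ω, f (R ω))) ∂P =
      1 / 2 * ∫ ω, stdS (Z ω) (U ω, V ω) ∂P := by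
  have hY : MemLp (fun ω => (U ω, V ω)) 2 P := MemLp.of_fst_snd ⟨h.memLp_noise, h.memLp_value⟩
  have hX := h.memLp_point
  have hZL : MemLp Z 2 P := (hY.condExp one_le_two).ae_eq hZ
  have hle := h.measurable_order.comap_le
  have hXm : AEStronglyMeasurable[MeasurableSpace.comap R inferInstance]
      (fun ω => (R ω, f (R ω))) P :=
    ((measurable_id.prodMk h.measurable_price).comp
      (comap_measurable R)).stronglyMeasurable.aestronglyMeasurable
  have h1 : ∫ ω, stdS (R ω, f (R ω)) (U ω, V ω) ∂P = ∫ ω, stdS (R ω, f (R ω)) (Z ω) ∂P :=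
    integral_bilin_condExp (stdSL m) hle hX hXm hY hZ
  rw [integral_sub (integrable_stdS hX hY) ((integrable_stdS hX hX).const_mul _), h1,
    integral_stdS_condExp hle hY hZ, ← integral_sub (integrable_stdS hX hZL)
      ((integrable_stdS hX hX).const_mul _), ← integral_const_mul]
  refine integral_congr_ae ?_
  filter_upwards [hZ2] with ω hω
  simp only [stdS, hω]
  rw [real_inner_comm (f (R ω)) (R ω), real_inner_comm (f (R ω)) (Z ω).1]
  ring

/-- Uniqueness of the equilibrium. The expectation of the Fitzpatrick function of the graph of the
pricing rule equals `E S(Z, Y) / 2` for the conditional expectation `Z` of `Y` given the order.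
Hence both attain the bound given by `fitzForm A`: `Z` is the optimal map, and the graph of the
pricing rule is in monotone relation with the graph of `A`. -/
lemma IsEquilibrium.unique [IsProbabilityMeasure P] (hA : IsPositive A)
    [(P.map fun ω => (U ω, V ω)).IsOpenPosMeasure] (hU : Measurable U) (hV : Measurable V)
    (hT : MeasurePreserving (reflL A) (P.map fun ω => (U ω, V ω)) (P.map fun ω => (U ω, V ω)))
    (h : IsEquilibrium P U V R f) :
    R =ᵐ[P] (fun ω => orderL A (U ω, V ω)) ∧ f = act A := by
  have hYm : Measurable fun ω => (U ω, V ω) := hU.prodMk hV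
  have hY : MemLp (fun ω => (U ω, V ω)) 2 P := MemLp.of_fst_snd ⟨h.memLp_noise, h.memLp_value⟩
  have hν : MemLp id 2 (P.map fun ω => (U ω, V ω)) :=
    (memLp_map_measure_iff aestronglyMeasurable_id hYm.aemeasurable).2 hY
  obtain ⟨g, hg, hRg⟩ := h.measurableWrt
  set G : Set (Phase m) := Set.range fun r => (r, f r) with hG
  set φ : Phase m → ℝ := fun y =>
    stdS (g y, f (g y)) y - 1 / 2 * stdS (g y, f (g y)) (g y, f (g y)) with hφ
  have hφm : Measurable φ := by
    have hx : Measurable fun y => (g y, f (g y)) := hg.prodMk (h.measurable_price.comp hg)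
    have hS : Measurable fun z : Phase m × Phase m => stdS z.1 z.2 :=
      (continuous_stdS continuous_fst continuous_snd).measurable
    exact (hS.comp (hx.prodMk measurable_id)).sub ((hS.comp (hx.prodMk hx)).const_mul _)
  have hφX : (fun ω => φ (U ω, V ω)) =ᵐ[P] fun ω => stdS (R ω, f (R ω)) (U ω, V ω) -
      1 / 2 * stdS (R ω, f (R ω)) (R ω, f (R ω)) := by
    filter_upwards [hRg] with ω hω
    simp only [hφ, hω]
  have hle : ∀ᵐ y ∂(P.map fun ω => (U ω, V ω)), fitzpatrick G y ≤ φ y := by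
    rw [ae_map_iff hYm.aemeasurable (measurableSet_le
      (lowerSemicontinuous_fitzpatrick G).measurable hφm.coe_real_ereal)]
    filter_upwards [h.ae_fitzpatrick_le, hφX] with ω h1 h2
    rw [h2]; exact h1
  have hφi : Integrable φ (P.map fun ω => (U ω, V ω)) := by
    refine (integrable_map_measure hφm.aestronglyMeasurable hYm.aemeasurable).2 ?_
    exact ((integrable_stdS h.memLp_point hY).sub
      ((integrable_stdS h.memLp_point h.memLp_point).const_mul _)).congr hφX.symm
  set Z := P[fun ω => (U ω, V ω) | MeasurableSpace.comap R inferInstance] with hZ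
  have hZ2 : ∀ᵐ ω ∂P, (Z ω).2 = f (R ω) := by
    filter_upwards [(ContinuousLinearMap.snd ℝ (Vec m) (Vec m)).comp_condExp_comm
      (m := MeasurableSpace.comap R inferInstance) (hY.integrable one_le_two), h.efficient]
      with ω h1 h2
    rw [h2]; exact h1
  have hval : ∫ y, φ y ∂(P.map fun ω => (U ω, V ω)) = 1 / 2 * ∫ ω, stdS (Z ω) (U ω, V ω) ∂P := by
    rw [integral_map hYm.aemeasurable hφm.aestronglyMeasurable, integral_congr_ae hφX]
    exact h.integral_eq EventuallyEq.rfl hZ2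
  have hfitz : ∫ y, fitzForm A y ∂(P.map fun ω => (U ω, V ω)) =
      ∫ ω, fitzForm A (U ω, V ω) ∂P :=
    integral_map hYm.aemeasurable (continuous_fitzForm A).aestronglyMeasurable
  have hcomap := h.measurable_order.comap_le
  have hS := half_stdS_le_fitzpatrick_range f
  -- Maximality of the graph of `A` gives `(r, f r)` in this graph for every `r`.
  have hprice : f = act A := by
    funext r
    have h1 := hA.eq_projL_of_monotone (y := (r, f r)) fun u => by
      rw [stdS_sub_comm]
      refine hA.nonneg_of_integral_le_fitzForm hT hν hS hφi hle ?_ (Set.mem_range_self r) u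
      rw [hval, hfitz]
      exact hA.half_integral_stdS_le hcomap hY EventuallyEq.rfl
    rw [projL_apply, Prod.mk.injEq] at h1
    rw [h1.2, ← h1.1]
  refine ⟨?_, hprice⟩
  have hZX : Z =ᵐ[P] fun ω => projL A (U ω, V ω) := by
    refine hA.ae_eq_projL hcomap hY EventuallyEq.rfl ?_
    rw [← hval, ← hfitz]
    exact integral_fitzForm_le hT hν hS hφi hle
  filter_upwards [hZX, hZ2] with ω h1 h2
  rw [h1, projL_apply, hprice] at h2
  by_contra hne
  have h3 := hA.inner_act_pos (sub_ne_zero.2 hne)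
  rw [← actL_apply, map_sub, actL_apply, actL_apply, ← h2] at h3
  simp at h3

end Equilibrium

end BackwardTransport

open BackwardTransport

theorem theorem11 {Ω : Type*} [MeasurableSpace Ω] (P : Measure Ω) [IsProbabilityMeasure P]
    (m : ℕ) (U V : Ω → Vec m) (hU : Measurable U) (hV : Measurable V)
    (Y : Ω → Phase m) (hY : Y = fun ω => (U ω, V ω))
    (hgauss : HasGaussianLaw Y P) (hcentered : ∫ ω, Y ω ∂P = 0)
    (Suu Suv Svu Svv : Matrix (Fin m) (Fin m) ℝ)
    (hSuu : Suu = crossMoment P U U) (hSuv : Suv = crossMoment P U V)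
    (hSvu : Svu = crossMoment P V U) (hSvv : Svv = crossMoment P V V)
    (hnondeg : (Matrix.fromBlocks Suu Suv Svu Svv).PosDef) :
    -- the Riccati equation has a unique positive-definite solution
    (∃! A : Matrix (Fin m) (Fin m) ℝ, IsPositive A ∧ Riccati Suu Suv Svu Svv A) ∧
    -- the symmetric equation has the unique positive-definite solution `Λ`
    (IsPositive (symLambda Suu Svv) ∧
      symLambda Suu Svv * Suu * symLambda Suu Svv = Svv ∧
      ∀ L : Matrix (Fin m) (Fin m) ℝ, IsPositive L → L * Suu * L = Svv →
        L = symLambda Suu Svv) ∧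
    ∀ A : Matrix (Fin m) (Fin m) ℝ, IsPositive A → Riccati Suu Suv Svu Svv A →
      IsUnit (A + Aᵀ) ∧
      -- the equilibrium
      (IsEquilibrium P U V (linearOrder A U V) (act A) ∧
        ∀ (R' : Ω → Vec m) (f' : Vec m → Vec m), IsEquilibrium P U V R' f' →
          R' =ᵐ[P] linearOrder A U V ∧ f' = act A) ∧
      -- the optimal map `X = (R, f(R))`
      (IsOptimalMap P Y (fun ω => (linearOrder A U V ω, act A (linearOrder A U V ω))) ∧
        ∀ Z : Ω → Phase m, IsOptimalMap P Y Z →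
          Z =ᵐ[P] fun ω => (linearOrder A U V ω, act A (linearOrder A U V ω))) ∧
      -- the optimal plan, the law of `(X, Y)`
      (IsOptimalPlan (P.map Y)
          (P.map fun ω => ((linearOrder A U V ω, act A (linearOrder A U V ω)), Y ω)) ∧
        ∀ γ : Measure (Phase m × Phase m), IsOptimalPlan (P.map Y) γ →
          γ = P.map fun ω => ((linearOrder A U V ω, act A (linearOrder A U V ω)), Y ω)) ∧
      -- the optimal set, the graph of `f`
      (IsOptimalSet (P.map Y) (Set.range fun u : Vec m => (u, act A u)) ∧
        ∀ G : Set (Phase m), IsOptimalSet (P.map Y) G →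
          G = Set.range fun u : Vec m => (u, act A u)) ∧
      -- the symmetric case
      (A.IsSymm ↔ symLambda Suu Svv * Suv = Svu * symLambda Suu Svv) ∧
      (A.IsSymm ↔ (symLambda Suu Svv * Suv).IsSymm) ∧
      (A.IsSymm → A = symLambda Suu Svv ∧ IsUnit (symLambda Suu Svv) ∧
        ∀ ω, linearOrder A U V ω =
          (1 / 2 : ℝ) • (U ω + act (symLambda Suu Svv)⁻¹ (V ω))) := by
  have hSu : Suu.PosDef := hnondeg.submatrix Sum.inl_injective
  have hSv : Svv.PosDef := hnondeg.submatrix Sum.inr_injective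
  have hSt : Suvᵀ = Svu := by
    have h := hnondeg.isSymm
    rw [Matrix.IsSymm, Matrix.fromBlocks_transpose, Matrix.fromBlocks_inj] at h
    exact h.2.2.1
  have hLam := posDef_symLambda hSu hSv
  have hLamS := symLambda_mul_mul hSu hSv
  have hYm : Measurable Y := hY ▸ hU.prodMk hV
  have hY2 : MemLp Y 2 P := hgauss.memLp_two
  have hopen : (P.map Y).IsOpenPosMeasure := by
    subst hY hSuu hSuv hSvu hSvv
    exact isOpenPosMeasure_map hgauss hcentered hnondeg
  have hT : ∀ A, IsPositive A → Riccati Suu Suv Svu Svv A →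
      MeasurePreserving (reflL A) (P.map Y) (P.map Y) := fun A hA hric => by
    subst hY hSuu hSuv hSvu hSvv
    exact hA.measurePreserving_reflL hgauss hcentered hric
  have hord : ∀ A ω, linearOrder A U V ω = orderL A (Y ω) := fun A ω => by
    rw [orderL_apply, hY]; rfl
  have hequil : ∀ A, IsPositive A → Riccati Suu Suv Svu Svv A →
      IsEquilibrium P U V (linearOrder A U V) (act A) := fun A hA hric => by
    have hT := hT A hA hric
    rw [funext (hord A)]
    subst hY
    exact hA.isEquilibrium hU hV hY2 hT
  have hequil_unique : ∀ A, IsPositive A → Riccati Suu Suv Svu Svv A →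
      ∀ (R' : Ω → Vec m) (f' : Vec m → Vec m), IsEquilibrium P U V R' f' →
        R' =ᵐ[P] linearOrder A U V ∧ f' = act A := fun A hA hric R' f' h => by
    have hT := hT A hA hric
    rw [funext (hord A)]
    subst hY
    exact h.unique hA hU hV hT
  -- The matrix is determined by the pricing rule, so the Riccati equation inherits uniqueness
  -- from the equilibrium.
  have huniq : ∀ A B, IsPositive A → Riccati Suu Suv Svu Svv A → IsPositive B →
      Riccati Suu Suv Svu Svv B → A = B := fun A B hA hricA hB hricB =>
    act_injective (hequil_unique B hB hricB _ _ (hequil A hA hricA)).2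
  obtain ⟨A₀, hA₀, hric₀⟩ := exists_isPositiveForm_riccati hnondeg
  refine ⟨⟨A₀, ⟨hA₀, hric₀⟩, fun B hB => huniq B A₀ hB.1 hB.2 hA₀ hric₀⟩,
    ⟨hLam.isPositiveForm, hLamS, fun L hL h => eq_symLambda hSu hSv hL h⟩, fun A hA hric => ?_⟩
  have hT := hT A hA hric
  have hX : (fun ω => (linearOrder A U V ω, act A (linearOrder A U V ω))) =
      fun ω => projL A (Y ω) := funext fun ω => by rw [hord, projL_apply]
  have hXY : (fun ω => ((linearOrder A U V ω, act A (linearOrder A U V ω)), Y ω)) =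
      fun ω => (projL A (Y ω), Y ω) := funext fun ω => by rw [hord, projL_apply]
  have hν : MemLp id 2 (P.map Y) :=
    (memLp_map_measure_iff aestronglyMeasurable_id hYm.aemeasurable).2 hY2
  have hsymm : A.IsSymm → A = symLambda Suu Svv := fun hs =>
    eq_symLambda hSu hSv hA (hric.of_isSymm hSu hSv hSt hs).1
  have hiff : A.IsSymm ↔ symLambda Suu Svv * Suv = Svu * symLambda Suu Svv := by
    refine ⟨fun hs => hsymm hs ▸ (hric.of_isSymm hSu hSv hSt hs).2, fun h => ?_⟩
    have hricL : Riccati Suu Suv Svu Svv (symLambda Suu Svv) := by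
      rw [Riccati, hLamS, h, sub_self, add_zero]
    rw [huniq A _ hA hric hLam.isPositiveForm hricL]
    exact hLam.isSymm
  rw [hX, hXY]
  refine ⟨hA.isUnit_add_transpose, ⟨hequil A hA hric, hequil_unique A hA hric⟩,
    ⟨hA.isOptimalMap_projL hYm hY2 hT, fun Z hZ => hA.ae_eq_projL_of_isOptimalMap hYm hY2 hT hZ⟩,
    ⟨hA.isOptimalPlan_map hYm hY2 hT, fun γ hγ => hA.eq_map_of_isOptimalPlan hYm hY2 hT hγ⟩,
    ⟨hA.isOptimalSet_graphSet hν hT, fun G hG => hA.eq_graphSet_of_isOptimalSet hν hT hG⟩,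
    hiff, hiff.trans (isSymm_mul_iff hLam.isSymm hSt).symm, fun hs => ?_⟩
  refine ⟨hsymm hs, hLam.isUnit, fun ω => ?_⟩
  rw [← hsymm hs, hord, hY]
  refine hA.orderL_eq ?_
  have hAA : act A (act A⁻¹ (V ω)) = V ω := by
    rw [act_act, Matrix.mul_nonsing_inv _ ((Matrix.isUnit_iff_isUnit_det _).1
      (hsymm hs ▸ hLam.isUnit)), act_one]
  rw [hs.eq, ← two_smul ℝ, ← actL_apply, map_smul, smul_smul, map_add, actL_apply, actL_apply, hAA]
  norm_num
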